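/- Let $\Gamma$ be a zero-sum stochastic game with finite (discrete) state space $K$, nonempty compact metrizable action sets $I$ (Player 1, maximizer) and $J$ (Player 2, minimizer), bounded Borel measurable payoff function $g:K\times I\times J\to\mathbb{R}$ and Borel measurable transition function $q:K\times I\times J\to\Delta(K)$, where $\Delta(\cdot)$ denotes the set of Borel probability measures with the weak$^*$ topology. Assume that $g$ and $q$ are separately continuous: for every $k\in K$, the maps $g(k,\cdot,j)$, $q(k,\cdot,j)$ $(j\in J)$ and $g(k,i,\cdot)$, $q(k,i,\cdot)$ $(i\in I)$ are continuous. At each stage $m\ge 1$, knowing the past states and actions and the current state $k_m$, the players choose actions $i_m\in I$ and $j_m\in J$ simultaneously and independently; the stage payoff is $g_m=g(k_m,i_m,j_m)$, and $k_{m+1}$ is drawn from $q(k_m,i_m,j_m)$. A behavioral strategy of Player 1 (resp. Player 2) is a Borel measurable map $\sigma$ (resp. $\tau$) from $\bigcup_{m\ge1}(K\times I\times J)^{m-1}\times K$ to $\Delta(I)$ (resp. $\Delta(J)$). An initial state $k_1$ and strategies $\sigma,\tau$ induce a probability measure on $(K\times I\times J)^{\mathbb{N}^*}$, with expectation $\mathbb{E}^{k_1}_{\sigma,\tau}$.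 The $n$-stage game ($n\ge1$) and the $\lambda$-discounted game ($\lambda\in(0,1]$) starting at $k_1$ are the zero-sum games with payoffs $\mathbb{E}^{k_1}_{\sigma,\tau}\big(\frac1n\sum_{m=1}^n g_m\big)$ and $\mathbb{E}^{k_1}_{\sigma,\tau}\big(\sum_{m\ge1}\lambda(1-\lambda)^{m-1}g_m\big)$. Then all these games have a value, that is, the $\sup_\sigma\inf_\tau$ and the $\inf_\tau\sup_\sigma$ of the payoff coincide; denote the values by $v_n(k_1)$ and $v_\lambda(k_1)$. Moreover, the following two statements are equivalent: (a) for all $k_1\in K$, $(v_n(k_1))$ converges when $n$ goes to infinity; (b) for all $k_1\in K$, $(v_\lambda(k_1))$ converges when $\lambda$ goes to $0$. When these statements hold, $\lim_{n\to+\infty}v_n(k_1)=\lim_{\lambda\to0}v_\lambda(k_1)$ for all $k_1\in K$. -/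

import Mathlib

open MeasureTheory ProbabilityTheory Filter Topology

/-- A zero-sum stochastic game with state space `K`, action sets `I` (Player 1) and `J` (Player 2):
a measurable transition function `q : K × I × J → Δ(K)` (a Markov kernel) and a bounded measurable
payoff function `g : K × I × J → ℝ`. -/
structure StochasticGame (K I J : Type*) [MeasurableSpace K] [MeasurableSpace I]
    [MeasurableSpace J] where
  /-- the transition function -/
  q : Kernel (K × I × J) K
  isMarkovKernel_q : IsMarkovKernel q
  /-- the payoff function -/
  g : K × I × J → ℝ
  measurable_g : Measurable g
  bounded_g : ∃ C : ℝ, ∀ z, |g z| ≤ C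

namespace StochasticGame

attribute [instance] StochasticGame.isMarkovKernel_q

/-- The possible histories before a stage, when `m` stages have been completed:
the states and actions of these `m` stages, and the current state. -/
abbrev Hist (K I J : Type*) (m : ℕ) : Type _ := (Fin m → K × I × J) × K

/-- A behavioral strategy of the player whose action set is `A` (which is `I` or `J`):
a measurable map from the finite histories to the probability measures on `A`. -/
structure Strategy (K I J A : Type*) [MeasurableSpace K] [MeasurableSpace I]
    [MeasurableSpace J] [MeasurableSpace A] where
  /-- the mixed action played after a history -/
  act : ∀ m : ℕ, Kernel (Hist K I J m) A
  isMarkovKernel_act : ∀ m, IsMarkovKernel (act m)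

attribute [instance] Strategy.isMarkovKernel_act

variable {K I J : Type*} [MeasurableSpace K] [MeasurableSpace I] [MeasurableSpace J]

/-- The law of `(k, i, j)` at a stage, given the history `(h, k)` before this stage: the players
choose `i` and `j` independently according to their strategies. -/
noncomputable def stageKernel (σ : Strategy K I J I) (τ : Strategy K I J J) (m : ℕ) :
    Kernel (Hist K I J m) (K × I × J) :=
  Kernel.deterministic Prod.snd measurable_snd ×ₖ (σ.act m ×ₖ τ.act m)

instance (σ : Strategy K I J I) (τ : Strategy K I J J) (m : ℕ) :
    IsMarkovKernel (stageKernel σ τ m) := by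
  unfold stageKernel; infer_instance

/-- The law of the history before the next stage, given the states and actions of the first `m + 1`
stages: the new state is drawn from `q` at the last state and actions. -/
noncomputable def histKernel (G : StochasticGame K I J) (m : ℕ) :
    Kernel (Fin (m + 1) → K × I × J) (Hist K I J (m + 1)) :=
  Kernel.id ×ₖ G.q.comap (fun h => h (Fin.last m)) (measurable_pi_apply _)

instance (G : StochasticGame K I J) (m : ℕ) : IsMarkovKernel (G.histKernel m) := by
  unfold histKernel; infer_instance

/-- Reindexing of the past stages, `{0, …, m}` being `Fin (m + 1)` or `Finset.Iic m`. -/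
def past (m : ℕ) (h : Finset.Iic m → K × I × J) : Fin (m + 1) → K × I × J :=
  fun i => h ⟨i, Finset.mem_Iic.2 (Nat.lt_succ_iff.1 i.2)⟩

lemma measurable_past (m : ℕ) : Measurable (past (K := K) (I := I) (J := J) m) :=
  measurable_pi_lambda _ fun _ => measurable_pi_apply _

/-- The law of the state and actions of the next stage, given those of the stages `0, …, m`. -/
noncomputable def transKernel (G : StochasticGame K I J) (σ : Strategy K I J I)
    (τ : Strategy K I J J) (m : ℕ) : Kernel (Finset.Iic m → K × I × J) (K × I × J) :=
  (stageKernel σ τ (m + 1) ∘ₖ G.histKernel m).comap (past m) (measurable_past m)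

instance (G : StochasticGame K I J) (σ : Strategy K I J I) (τ : Strategy K I J J) (m : ℕ) :
    IsMarkovKernel (G.transKernel σ τ m) := by
  unfold transKernel; infer_instance

/-- The probability measure induced on the infinite plays by the initial state `k₁` and the
strategies `σ`, `τ` (Ionescu-Tulcea); the stages are numbered from `0`. -/
noncomputable def playMeasure (G : StochasticGame K I J) (k₁ : K) (σ : Strategy K I J I)
    (τ : Strategy K I J J) : Measure (ℕ → K × I × J) :=
  Kernel.trajMeasure (X := fun _ : ℕ => K × I × J)
    (stageKernel σ τ 0 (Fin.elim0, k₁)) (G.transKernel σ τ)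

/-- The payoff in the `lam`-discounted game starting at `k₁`. -/
noncomputable def discountedPayoff (G : StochasticGame K I J) (lam : ℝ) (k₁ : K)
    (σ : Strategy K I J I) (τ : Strategy K I J J) : ℝ :=
  ∫ z, ∑' m : ℕ, lam * (1 - lam) ^ m * G.g (z m) ∂(G.playMeasure k₁ σ τ)

/-- The payoff in the `n`-stage game starting at `k₁`. -/
noncomputable def stagePayoff (G : StochasticGame K I J) (n : ℕ) (k₁ : K)
    (σ : Strategy K I J I) (τ : Strategy K I J J) : ℝ :=
  ∫ z, (n : ℝ)⁻¹ * ∑ m ∈ Finset.range n, G.g (z m) ∂(G.playMeasure k₁ σ τ)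

/-- A zero-sum game, in which Player 1 chooses `σ` to maximize the (bounded) payoff `γ σ τ` and
Player 2 chooses `τ` to minimize it, has a value. -/
def HasValue {S T : Type*} (γ : S → T → ℝ) : Prop :=
  ⨆ σ, ⨅ τ, γ σ τ = ⨅ τ, ⨆ σ, γ σ τ

/-- The value of a zero-sum game with bounded payoff `γ`, provided that it has one. -/
noncomputable def value {S T : Type*} (γ : S → T → ℝ) : ℝ :=
  ⨆ σ, ⨅ τ, γ σ τ

/-- The value `v_n(k₁)` of the `n`-stage game starting at `k₁`. -/
noncomputable def stageValue (G : StochasticGame K I J) (n : ℕ) (k₁ : K) : ℝ :=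
  value (G.stagePayoff n k₁)

/-- The value `v_lam(k₁)` of the `lam`-discounted game starting at `k₁`. -/
noncomputable def discountedValue (G : StochasticGame K I J) (lam : ℝ) (k₁ : K) : ℝ :=
  value (G.discountedPayoff lam k₁)

/-- The transition function, with values in the space of probability measures on `K`, which carries
the weak-* topology. -/
noncomputable def transProb (G : StochasticGame K I J) (z : K × I × J) : ProbabilityMeasure K :=
  ⟨G.q z, inferInstance⟩

/-- The payoff and the transition are continuous in the action of each player separately. -/
structure SeparatelyContinuous [TopologicalSpace K] [OpensMeasurableSpace K] [TopologicalSpace I]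
    [TopologicalSpace J] (G : StochasticGame K I J) : Prop where
  g_left : ∀ k j, Continuous fun i => G.g (k, i, j)
  g_right : ∀ k i, Continuous fun j => G.g (k, i, j)
  q_left : ∀ k j, Continuous fun i => G.transProb (k, i, j)
  q_right : ∀ k i, Continuous fun j => G.transProb (k, i, j)

end StochasticGame

/-! The game reduces to one operator. Let `Φ w f k` be the value in mixed actions of the one-shot
game at state `k` with payoff `w * g` plus the expectation of `f` under the transition. It exists by
a minimax theorem: continuity in Player 1's action makes the mixed payoffs weak-* continuous on a
compact space, so Player 2 needs to consider only finitely many actions, and finite-dimensional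
separation applies. Comparing one-shot payoffs shows that `Φ` is `C`-Lipschitz in `w`, nonexpansive
in `f` for the sup norm, and positively homogeneous in `(w, f)`. Dynamic programming with Markov
strategies identifies `v_n` with `n⁻¹ • (Φ 1)^[n] 0` and `v_lam` with the fixed point of `D f = Φ
lam ((1 - lam) • f)`.

The equivalence is then a Tauberian theorem about such operators in a normed space. The key estimate
is `norm_discounted_iterate_sub_le`: over a block of `M` stages, discounting differs from the
constant weight `lam` by `O((M * lam)^2)`, whereas the block itself has weight about `M * lam`. The
relative error is thus small when `M * lam` is.

From discounted to finite games (`tendsto_iterate`), take `lam = 1 / R`: the block estimate bounds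
the error `‖(Φ 1)^[R] 0 - R • v‖` by the error at `R - M` plus a small multiple of `M`, where `M` is
about `δ * R`; induction makes the error at most `A + κ * R`. Conversely (`tendsto_discounted`), if
`(Φ 1)^[n] 0` is close to `n • v`, then `v` is nearly fixed by `D^[M]` with `M` about `δ / lam`.
Since `D^[M]` contracts by at least `1 - M * lam / 2`, its fixed point is close to `v`. -/

/-! ### Minimax theorem for one-shot games -/

section Minimax

variable {I J : Type*} [MeasurableSpace I] [MeasurableSpace J]

/-- `c` is the value of the mixed extension of the zero-sum game with payoff `h`: both players
have `ε`-optimal mixed actions. -/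
def IsMixedValue (h : I → J → ℝ) (c : ℝ) : Prop :=
  ∀ ε > 0, (∃ x : ProbabilityMeasure I, ∀ j, c - ε ≤ ∫ i, h i j ∂(x : Measure I)) ∧
    ∃ y : ProbabilityMeasure J, ∀ i, ∫ j, h i j ∂(y : Measure J) ≤ c + ε

lemma integrable_of_measurable_of_abs_le {α : Type*} [MeasurableSpace α] {μ : Measure α}
    [IsFiniteMeasure μ] {f : α → ℝ} (hf : Measurable f) {C : ℝ} (hC : ∀ a, |f a| ≤ C) :
    Integrable f μ :=
  Integrable.of_bound hf.aestronglyMeasurable C (ae_of_all _ hC)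

lemma abs_integral_le_of_abs_le {α : Type*} [MeasurableSpace α] {μ : Measure α}
    [IsProbabilityMeasure μ] {f : α → ℝ} {C : ℝ} (hC : ∀ a, |f a| ≤ C) :
    |∫ a, f a ∂μ| ≤ C := by
  simpa using norm_integral_le_of_norm_le_const (μ := μ) (f := f) (ae_of_all _ hC)

lemma integral_le_of_le {α : Type*} [MeasurableSpace α] {μ : Measure α}
    [IsProbabilityMeasure μ] {f : α → ℝ} {c : ℝ} (hf : Integrable f μ) (h : ∀ a, f a ≤ c) :
    ∫ a, f a ∂μ ≤ c := by
  simpa using integral_mono hf (integrable_const c) h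

lemma le_integral_of_le {α : Type*} [MeasurableSpace α] {μ : Measure α}
    [IsProbabilityMeasure μ] {f : α → ℝ} {c : ℝ} (hf : Integrable f μ) (h : ∀ a, c ≤ f a) :
    c ≤ ∫ a, f a ∂μ := by
  simpa using integral_mono (integrable_const c) hf h

/-- Weak duality: what the first player guarantees is at most what the second one guarantees. -/
lemma le_of_guarantees {h : I → J → ℝ} (hm : Measurable (Function.uncurry h)) {C : ℝ}
    (hC : ∀ i j, |h i j| ≤ C) {x : Measure I} {y : Measure J} [IsProbabilityMeasure x]
    [IsProbabilityMeasure y] {a b : ℝ} (hx : ∀ j, a ≤ ∫ i, h i j ∂x)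
    (hy : ∀ i, ∫ j, h i j ∂y ≤ b) : a ≤ b := by
  have hint : Integrable (Function.uncurry h) (x.prod y) :=
    integrable_of_measurable_of_abs_le hm fun z => hC z.1 z.2
  calc a ≤ ∫ j, ∫ i, h i j ∂x ∂y := le_integral_of_le hint.integral_prod_right hx
    _ = ∫ i, ∫ j, h i j ∂y ∂x := (integral_integral_swap hint).symm
    _ ≤ b := integral_le_of_le hint.integral_prod_left hy

/-- Play a near-optimal `x` for `h` against a near-optimal `y` for `h'` and apply weak duality to
`h`. Taken with `d = 0` in both directions, this gives uniqueness of the value. -/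
lemma IsMixedValue.le_add {h h' : I → J → ℝ} {c c' d : ℝ} (hc : IsMixedValue h c)
    (hc' : IsMixedValue h' c') (hm : Measurable (Function.uncurry h))
    (hm' : Measurable (Function.uncurry h')) {C C' : ℝ} (hC : ∀ i j, |h i j| ≤ C)
    (hC' : ∀ i j, |h' i j| ≤ C') (hd : ∀ i j, h i j ≤ h' i j + d) : c ≤ c' + d := by
  refine le_of_forall_pos_le_add fun ε hε => ?_
  obtain ⟨x, hx⟩ := (hc (ε / 2) (half_pos hε)).1
  obtain ⟨y, hy⟩ := (hc' (ε / 2) (half_pos hε)).2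
  have key : c - ε / 2 ≤ c' + ε / 2 + d := by
    refine le_of_guarantees hm hC (x := (x : Measure I)) (y := (y : Measure J)) hx fun i => ?_
    have h1 : Integrable (h i) (y : Measure J) :=
      integrable_of_measurable_of_abs_le (hm.comp measurable_prodMk_left) (hC i)
    have h2 : Integrable (h' i) (y : Measure J) :=
      integrable_of_measurable_of_abs_le (hm'.comp measurable_prodMk_left) (hC' i)
    have h3 := integral_mono h1 (h2.add (integrable_const d)) (hd i)
    have h4 : ∫ j, (h' i j + d) ∂(y : Measure J) = ∫ j, h' i j ∂(y : Measure J) + d := by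
      simpa using integral_add h2 (integrable_const d)
    simp only [Pi.add_apply] at h3
    linarith [hy i]
  linarith

lemma IsMixedValue.const_mul {h : I → J → ℝ} {c s : ℝ} (hc : IsMixedValue h c) (hs : 0 ≤ s) :
    IsMixedValue (fun i j => s * h i j) (s * c) := by
  intro ε hε
  -- Dividing by `s + 1` rather than `s` covers the case `s = 0`.
  have hε' : 0 < ε / (s + 1) := by positivity
  have hle : s * (ε / (s + 1)) ≤ ε := by
    rw [mul_div_assoc', div_le_iff₀ (by positivity)]
    nlinarith
  obtain ⟨⟨x, hx⟩, y, hy⟩ := hc _ hε'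
  refine ⟨⟨x, fun j => ?_⟩, y, fun i => ?_⟩
  · rw [integral_const_mul]
    nlinarith [mul_le_mul_of_nonneg_left (hx j) hs]
  · rw [integral_const_mul]
    nlinarith [mul_le_mul_of_nonneg_left (hy i) hs]

/-- A finite theorem of the alternative: if a convex set of vectors meets no orthant
`{u | c < u}`, some weighted average of the coordinates is at most `c` on it. -/
lemma exists_weights_of_convex {ι : Type*} [Fintype ι] {S : Set (ι → ℝ)} (hS : Convex ℝ S)
    (hne : S.Nonempty) {c : ℝ} (hc : ∀ u ∈ S, ∃ l, u l ≤ c) :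
    ∃ p : ι → ℝ, (∀ l, 0 ≤ p l) ∧ ∑ l, p l = 1 ∧ ∀ u ∈ S, ∑ l, p l * u l ≤ c := by
  classical
  set O : Set (ι → ℝ) := Set.univ.pi fun _ => Set.Ioi c with hO
  have hOc : Convex ℝ O := convex_pi fun _ _ => convex_Ioi c
  have hOo : IsOpen O := isOpen_set_pi Set.finite_univ fun _ _ => isOpen_Ioi
  have hdisj : Disjoint O S := by
    rw [Set.disjoint_left]
    intro u hu hu'
    obtain ⟨l, hl⟩ := hc u hu'
    exact absurd (hu l (Set.mem_univ l)) (not_lt.2 hl)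
  obtain ⟨f, a, hfO, hfS⟩ := geometric_hahn_banach_open hOc hOo hS hdisj
  set p : ι → ℝ := fun l => -f (Pi.single l 1) with hp
  have hf : ∀ u, f u = -∑ l, p l * u l := by
    intro u
    conv_lhs => rw [← Finset.univ_sum_single u]
    rw [map_sum, ← Finset.sum_neg_distrib]
    refine Finset.sum_congr rfl fun l _ => ?_
    have : (Pi.single l (u l) : ι → ℝ) = u l • Pi.single l 1 := by
      rw [← Pi.single_smul, smul_eq_mul, mul_one]
    rw [this, map_smul, smul_eq_mul]
    simp only [hp]
    ring
  have hmem : ∀ t > 0, (fun _ => c + t : ι → ℝ) ∈ O := fun t ht l _ => by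
    simpa using ht
  -- If `p l < 0`, raising coordinate `l` stays in the orthant but makes `f` unbounded above there,
  -- against `f < a`.
  have hp0 : ∀ l, 0 ≤ p l := by
    intro l
    by_contra hneg
    push Not at hneg
    have h1 : ∀ t > 0, -(∑ l, p l) * (c + 1) - t * p l < a := by
      intro t ht
      have h2 := hfO (fun m => c + 1 + (Pi.single l t : ι → ℝ) m) (fun m _ => by
        have : 0 ≤ (Pi.single l t : ι → ℝ) m := by
          by_cases hml : m = l
          · subst hml; simpa using ht.le
          · simp [Pi.single_eq_of_ne hml]
        simp only [Set.mem_Ioi]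
        linarith)
      rw [hf] at h2
      have h3 : ∑ m, p m * (c + 1 + (Pi.single l t : ι → ℝ) m)
          = (∑ m, p m) * (c + 1) + p l * t := by
        simp_rw [mul_add (p _) (c + 1), Finset.sum_add_distrib, ← Finset.sum_mul]
        simp [Pi.single_apply]
      rw [h3] at h2
      linarith
    have h3 := h1 ((|a + (∑ l, p l) * (c + 1)| + 1) / (-p l)) (by
      have : 0 < -p l := by linarith
      positivity)
    have h4 : (|a + (∑ l, p l) * (c + 1)| + 1) / (-p l) * p l
        = -(|a + (∑ l, p l) * (c + 1)| + 1) := by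
      rw [div_neg, neg_mul, div_mul_cancel₀ _ hneg.ne]
    rw [h4] at h3
    linarith [le_abs_self (a + (∑ l, p l) * (c + 1))]
  -- Let points of the orthant tend to its corner, the constant vector `c`.
  have hle : -((∑ l, p l) * c) ≤ a := by
    refine le_of_forall_pos_lt_add fun ε hε => ?_
    have hs : 0 ≤ ∑ l, p l := Finset.sum_nonneg fun l _ => hp0 l
    have h1 := hfO _ (hmem (ε / (∑ l, p l + 1)) (by positivity))
    rw [hf, ← Finset.sum_mul] at h1
    have h2 : (∑ l, p l) * (ε / (∑ l, p l + 1)) ≤ ε := by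
      rw [mul_div_assoc', div_le_iff₀ (by positivity)]
      nlinarith
    linarith
  -- Otherwise `f = 0`, which cannot be both `< a` on the orthant and `≥ a` on the nonempty set `S`.
  have hpos : 0 < ∑ l, p l := by
    refine lt_of_le_of_ne (Finset.sum_nonneg fun l _ => hp0 l) fun h0 => ?_
    have hz := (Finset.sum_eq_zero_iff_of_nonneg fun l _ => hp0 l).1 h0.symm
    have hf0 : ∀ u, f u = 0 := fun u => by
      rw [hf, Finset.sum_eq_zero fun l hl => by rw [hz l hl, zero_mul], neg_zero]
    obtain ⟨b, hb⟩ := hne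
    have h1 := hfO _ (hmem 1 one_pos)
    have h2 := hfS b hb
    rw [hf0] at h1 h2
    linarith
  refine ⟨fun l => p l / ∑ l, p l, fun l => div_nonneg (hp0 l) hpos.le, ?_, fun u hu => ?_⟩
  · rw [← Finset.sum_div, div_self hpos.ne']
  · have h1 := hfS u hu
    rw [hf] at h1
    simp only [div_mul_eq_mul_div]
    rw [← Finset.sum_div, div_le_iff₀ hpos]
    linarith

/-- A measurable bounded payoff, continuous in the action of the first player, which lies in a
compact metrizable space, has a value in mixed actions. -/
theorem exists_isMixedValue [TopologicalSpace I] [CompactSpace I]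
    [TopologicalSpace.MetrizableSpace I] [BorelSpace I] [Nonempty I] [Nonempty J]
    [MeasurableSingletonClass J] {h : I → J → ℝ} (hcont : ∀ j, Continuous fun i => h i j)
    (hm : Measurable (Function.uncurry h)) {C : ℝ} (hC : ∀ i j, |h i j| ≤ C) :
    ∃ c, IsMixedValue h c := by
  classical
  have hmI : ∀ j, Measurable fun i => h i j := fun j => hm.comp measurable_prodMk_right
  have hint : ∀ (x : Measure I) [IsFiniteMeasure x] (j : J), Integrable (fun i => h i j) x :=
    fun x _ j => integrable_of_measurable_of_abs_le (hmI j) fun i => hC i j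
  have hbdd : ∀ x : ProbabilityMeasure I,
      BddBelow (Set.range fun j => ∫ i, h i j ∂(x : Measure I)) := by
    rintro x
    refine ⟨-C, ?_⟩
    rintro _ ⟨j, rfl⟩
    exact (abs_le.1 (abs_integral_le_of_abs_le fun i => hC i j)).1
  have hbdd' : BddAbove (Set.range fun x : ProbabilityMeasure I =>
      ⨅ j, ∫ i, h i j ∂(x : Measure I)) := by
    refine ⟨C, ?_⟩
    rintro _ ⟨x, rfl⟩
    obtain ⟨j⟩ := ‹Nonempty J›
    exact (ciInf_le (hbdd x) j).trans
      (abs_le.1 (abs_integral_le_of_abs_le fun i => hC i j)).2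
  have : Nonempty (ProbabilityMeasure I) :=
    ⟨⟨Measure.dirac (Classical.arbitrary I), inferInstance⟩⟩
  refine ⟨⨆ x : ProbabilityMeasure I, ⨅ j, ∫ i, h i j ∂(x : Measure I), fun ε hε => ⟨?_, ?_⟩⟩
  · obtain ⟨x, hx⟩ := exists_lt_of_lt_ciSup (sub_lt_self
      (⨆ x : ProbabilityMeasure I, ⨅ j, ∫ i, h i j ∂(x : Measure I)) hε)
    exact ⟨x, fun j => hx.le.trans (ciInf_le (hbdd x) j)⟩
  · set c := (⨆ x : ProbabilityMeasure I, ⨅ j, ∫ i, h i j ∂(x : Measure I)) + ε with hc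
    have hcov : ∀ x : ProbabilityMeasure I, ∃ j, ∫ i, h i j ∂(x : Measure I) < c := fun x =>
      exists_lt_of_ciInf_lt ((le_ciSup hbdd' x).trans_lt (lt_add_of_pos_right _ hε))
    have hopen : ∀ j, IsOpen {x : ProbabilityMeasure I | ∫ i, h i j ∂(x : Measure I) < c} := by
      intro j
      refine isOpen_lt ?_ continuous_const
      exact ProbabilityMeasure.continuous_integral_boundedContinuousFunction
        (BoundedContinuousFunction.mkOfCompact ⟨fun i => h i j, hcont j⟩)
    -- By weak-* compactness, the finitely many replies in `t` already hold every mixed action of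
    -- Player 1 below `c`.
    obtain ⟨t, ht⟩ := isCompact_univ.elim_finite_subcover _ hopen fun x _ =>
      Set.mem_iUnion.2 (hcov x)
    set S : Set (t → ℝ) := {u | ∃ x : Measure I, IsProbabilityMeasure x ∧
      ∀ l : t, u l = ∫ i, h i l ∂x} with hS
    have hSconv : Convex ℝ S := by
      rintro u ⟨x, hx, hu⟩ u' ⟨x', hx', hu'⟩ a b ha hb hab
      refine ⟨ENNReal.ofReal a • x + ENNReal.ofReal b • x', ⟨?_⟩, fun l => ?_⟩
      · simp [← ENNReal.ofReal_add ha hb, hab]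
      · rw [integral_add_measure ((hint x l).smul_measure ENNReal.ofReal_ne_top)
          ((hint x' l).smul_measure ENNReal.ofReal_ne_top), integral_smul_measure,
          integral_smul_measure, ENNReal.toReal_ofReal ha, ENNReal.toReal_ofReal hb]
        simp [hu l, hu' l]
    have hdirac : ∀ i, (fun l : t => h i l) ∈ S := fun i =>
      ⟨Measure.dirac i, inferInstance, fun l => (integral_dirac (fun i => h i l) i).symm⟩
    obtain ⟨p, hp0, hp1, hp⟩ := exists_weights_of_convex (c := c) hSconv
      ⟨_, hdirac (Classical.arbitrary I)⟩ (by
        rintro u ⟨x, hx, hu⟩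
        obtain ⟨l, hl, hlt⟩ := Set.mem_iUnion₂.1 (ht (Set.mem_univ ⟨x, hx⟩))
        exact ⟨⟨l, hl⟩, by rw [hu]; exact le_of_lt hlt⟩)
    -- The separating weights, read as a finitely supported mixed action of Player 2, hold every
    -- pure action `i` to at most `c`.
    refine ⟨⟨∑ l : t, ENNReal.ofReal (p l) • Measure.dirac (l : J), ⟨?_⟩⟩, fun i => ?_⟩
    · simpa [Measure.finsetSum_apply, ← ENNReal.ofReal_sum_of_nonneg fun l _ => hp0 l] using hp1
    · have hmi : Measurable (h i) := hm.comp measurable_prodMk_left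
      refine le_trans (le_of_eq ?_) (hp _ (hdirac i))
      simp only [ProbabilityMeasure.coe_mk]
      rw [integral_finsetSum_measure fun l _ => (integrable_of_measurable_of_abs_le hmi
        (hC i)).smul_measure ENNReal.ofReal_ne_top]
      refine Finset.sum_congr rfl fun l _ => ?_
      rw [integral_smul_measure, integral_dirac, ENNReal.toReal_ofReal (hp0 l), smul_eq_mul]

end Minimax

/-! ### Tauberian theorem for Shapley operators -/

section Tauberian

variable {X : Type*} [NormedAddCommGroup X] [NormedSpace ℝ X]

/-- An operator `Φ w f`, where `w` is the weight of the current stage and `f` the continuation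
payoff, which is positively homogeneous, Lipschitz in `w` and nonexpansive in `f`. -/
structure IsShapleyOperator (Φ : ℝ → X → X) (C : ℝ) : Prop where
  nonneg : 0 ≤ C
  norm_sub_le : ∀ w w' f f', ‖Φ w f - Φ w' f'‖ ≤ C * |w - w'| + ‖f - f'‖
  smul : ∀ s, 0 ≤ s → ∀ w f, Φ (s * w) (s • f) = s • Φ w f

namespace IsShapleyOperator

variable {Φ : ℝ → X → X} {C : ℝ}

lemma nonexpansive (h : IsShapleyOperator Φ C) (w : ℝ) (f f' : X) :
    ‖Φ w f - Φ w f'‖ ≤ ‖f - f'‖ := by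
  simpa using h.norm_sub_le w w f f'

lemma map_zero (h : IsShapleyOperator Φ C) : Φ 0 0 = 0 := by
  simpa using h.smul 0 le_rfl 0 0

lemma norm_le (h : IsShapleyOperator Φ C) {w : ℝ} (hw : 0 ≤ w) (f : X) :
    ‖Φ w f‖ ≤ C * w + ‖f‖ := by
  simpa [h.map_zero, abs_of_nonneg hw] using h.norm_sub_le w 0 f 0

lemma iterate_nonexpansive (h : IsShapleyOperator Φ C) (w : ℝ) (M : ℕ) (f f' : X) :
    ‖(Φ w)^[M] f - (Φ w)^[M] f'‖ ≤ ‖f - f'‖ := by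
  induction M with
  | zero => simp
  | succ M ih =>
    rw [Function.iterate_succ_apply', Function.iterate_succ_apply']
    exact (h.nonexpansive w _ _).trans ih

lemma iterate_smul (h : IsShapleyOperator Φ C) {s : ℝ} (hs : 0 ≤ s) (M : ℕ) (f : X) :
    (Φ s)^[M] (s • f) = s • (Φ 1)^[M] f := by
  induction M with
  | zero => simp
  | succ M ih =>
    rw [Function.iterate_succ_apply', Function.iterate_succ_apply', ih, ← h.smul s hs, mul_one]

lemma norm_iterate_zero_le (h : IsShapleyOperator Φ C) (n : ℕ) :
    ‖(Φ 1)^[n] 0‖ ≤ C * n := by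
  induction n with
  | zero => simp
  | succ n ih =>
    rw [Function.iterate_succ_apply']
    refine (h.norm_le zero_le_one _).trans ?_
    push_cast
    linarith

lemma discounted_nonexpansive (h : IsShapleyOperator Φ C) {lam : ℝ} (h1 : lam ≤ 1) (f f' : X) :
    ‖Φ lam ((1 - lam) • f) - Φ lam ((1 - lam) • f')‖ ≤ (1 - lam) * ‖f - f'‖ := by
  refine (h.nonexpansive _ _ _).trans ?_
  rw [← smul_sub, norm_smul, Real.norm_of_nonneg (by linarith)]

lemma discounted_iterate_nonexpansive (h : IsShapleyOperator Φ C) {lam : ℝ} (h1 : lam ≤ 1)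
    (M : ℕ) (f f' : X) :
    ‖(fun f => Φ lam ((1 - lam) • f))^[M] f - (fun f => Φ lam ((1 - lam) • f))^[M] f'‖
      ≤ (1 - lam) ^ M * ‖f - f'‖ := by
  induction M with
  | zero => simp
  | succ M ih =>
    rw [Function.iterate_succ_apply', Function.iterate_succ_apply']
    refine (h.discounted_nonexpansive h1 _ _).trans ?_
    rw [pow_succ' (1 - lam), mul_assoc]
    exact mul_le_mul_of_nonneg_left ih (by linarith)

/-- The discounted game has a fixed point. -/
lemma exists_fixedPoint [CompleteSpace X] (h : IsShapleyOperator Φ C) {lam : ℝ} (h0 : 0 < lam)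
    (h1 : lam ≤ 1) : ∃ u, Φ lam ((1 - lam) • u) = u := by
  have hc : ContractingWith (1 - lam).toNNReal fun f => Φ lam ((1 - lam) • f) := by
    refine ⟨?_, LipschitzWith.of_dist_le_mul fun f f' => ?_⟩
    · rw [← NNReal.coe_lt_coe, Real.coe_toNNReal _ (by linarith)]
      simpa using h0
    · rw [dist_eq_norm, dist_eq_norm, Real.coe_toNNReal _ (by linarith)]
      exact h.discounted_nonexpansive h1 f f'
  exact ⟨_, hc.fixedPoint_isFixedPt⟩

lemma norm_fixedPoint_le (h : IsShapleyOperator Φ C) {lam : ℝ} (h0 : 0 < lam) (h1 : lam ≤ 1)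
    {u : X} (hu : Φ lam ((1 - lam) • u) = u) : ‖u‖ ≤ C := by
  have h2 := h.norm_le h0.le ((1 - lam) • u)
  rw [hu, norm_smul, Real.norm_of_nonneg (by linarith)] at h2
  have h3 : lam * ‖u‖ ≤ lam * C := by linarith
  exact le_of_mul_le_mul_left h3 h0

/-- By homogeneity the factor `s` enters `Φ`, giving the first stage weight `s * lam`; replacing it
by `lam` costs `C * lam * (1 - s)`. The remaining stages carry the factor `s * (1 - lam)`, which is
why the induction needs all `s`. -/
lemma norm_smul_discounted_iterate_sub_le (h : IsShapleyOperator Φ C) {lam : ℝ} (h0 : 0 ≤ lam)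
    (h1 : lam ≤ 1) (f : X) (M : ℕ) : ∀ s, 0 ≤ s → s ≤ 1 →
    ‖s • (fun f => Φ lam ((1 - lam) • f))^[M] f - (Φ lam)^[M] ((s * (1 - lam) ^ M) • f)‖
      ≤ C * lam * M * (1 - s * (1 - lam) ^ M) := by
  induction M with
  | zero => intro s _ _; simp
  | succ M ih =>
    intro s hs0 hs1
    have hl : 0 ≤ 1 - lam := by linarith
    have hs' : s * (1 - lam) ≤ 1 := mul_le_one₀ hs1 hl (by linarith)
    have ih' := ih (s * (1 - lam)) (by positivity) hs'
    rw [Function.iterate_succ_apply', Function.iterate_succ_apply', ← h.smul s hs0, smul_smul]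
    refine (h.norm_sub_le _ _ _ _).trans ?_
    have e1 : s * (1 - lam) * (1 - lam) ^ M = s * (1 - lam) ^ (M + 1) := by ring
    rw [e1] at ih'
    have e2 : |s * lam - lam| = lam * (1 - s) := by
      rw [show s * lam - lam = -(lam * (1 - s)) by ring, abs_neg,
        abs_of_nonneg (mul_nonneg h0 (by linarith))]
    have e3 : s * (1 - lam) ^ (M + 1) ≤ s :=
      mul_le_of_le_one_right hs0 (pow_le_one₀ hl (by linarith))
    have e4 : C * lam * (1 - s) ≤ C * lam * (1 - s * (1 - lam) ^ (M + 1)) :=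
      mul_le_mul_of_nonneg_left (by linarith) (mul_nonneg h.nonneg h0)
    rw [e2]
    push_cast
    linarith

/-- The sign is Bernoulli's inequality. The upper bound is by induction from `(1 - lam) * (1 - M *
lam) = 1 - (M + 1) * lam + M * lam ^ 2`. -/
lemma abs_pow_sub_le {lam : ℝ} (h0 : 0 ≤ lam) (h1 : lam ≤ 1) (M : ℕ) :
    |(1 - lam) ^ M - (1 - M * lam)| ≤ (M * lam) ^ 2 := by
  have hb : 1 - M * lam ≤ (1 - lam) ^ M := by
    have := one_add_mul_le_pow (a := -lam) (by linarith) M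
    rw [← sub_eq_add_neg] at this
    linarith
  rw [abs_of_nonneg (by linarith)]
  clear hb
  induction M with
  | zero => simp
  | succ M ih =>
    have h2 : (1 - lam) * ((1 - lam) ^ M - (1 - M * lam)) ≤ (M * lam) ^ 2 := by
      have : 0 ≤ (M * lam) ^ 2 := by positivity
      nlinarith
    have h3 : (0 : ℝ) ≤ M := M.cast_nonneg
    have h4 : 0 ≤ (M : ℝ) * lam ^ 2 := by positivity
    push_cast
    rw [pow_succ]
    nlinarith

/-- Over a block of `M` stages with `M * lam` small, discounting is almost the same as giving the
weight `lam` to each stage of the block. -/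
lemma norm_discounted_iterate_sub_le (h : IsShapleyOperator Φ C) {lam : ℝ} (h0 : 0 ≤ lam)
    (h1 : lam ≤ 1) (f : X) (M : ℕ) :
    ‖(fun f => Φ lam ((1 - lam) • f))^[M] f - (Φ lam)^[M] ((1 - M * lam) • f)‖
      ≤ (C + ‖f‖) * (M * lam) ^ 2 := by
  have h2 := h.norm_smul_discounted_iterate_sub_le h0 h1 f M 1 zero_le_one le_rfl
  rw [one_smul, one_mul] at h2
  have h3 := h.iterate_nonexpansive lam M ((1 - lam) ^ M • f) ((1 - M * lam) • f)
  rw [← sub_smul, norm_smul, Real.norm_eq_abs] at h3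
  have h4 := mul_le_mul_of_nonneg_right (abs_pow_sub_le h0 h1 M) (norm_nonneg f)
  have h5 : 1 - (1 - lam) ^ M ≤ M * lam := by
    have := one_add_mul_le_pow (a := -lam) (by linarith) M
    rw [← sub_eq_add_neg] at this
    linarith
  have h6 : C * lam * M * (1 - (1 - lam) ^ M) ≤ C * lam * M * (M * lam) :=
    mul_le_mul_of_nonneg_left h5 (mul_nonneg (mul_nonneg h.nonneg h0) M.cast_nonneg)
  have h7 := norm_sub_le_norm_sub_add_norm_sub
    ((fun f => Φ lam ((1 - lam) • f))^[M] f) ((Φ lam)^[M] ((1 - lam) ^ M • f))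
    ((Φ lam)^[M] ((1 - M * lam) • f))
  linarith

/-- If the discounted values converge, the values of the finitely repeated games converge to the
same limit. -/
theorem tendsto_iterate (h : IsShapleyOperator Φ C) {u : ℝ → X}
    (hu : ∀ lam, 0 < lam → lam ≤ 1 → Φ lam ((1 - lam) • u lam) = u lam) {v : X}
    (hv : Tendsto u (𝓝[>] 0) (𝓝 v)) :
    Tendsto (fun n : ℕ => (n : ℝ)⁻¹ • (Φ 1)^[n] 0) atTop (𝓝 v) := by
  have hC := h.nonneg
  have hblock : ∀ ε > 0, ∃ R₀ : ℕ, 0 < R₀ ∧ ∀ R ≥ R₀, ∀ M ≤ R,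
      ‖(Φ 1)^[R] 0 - (R : ℝ) • v‖ ≤ ‖(Φ 1)^[R - M] 0 - ((R - M : ℕ) : ℝ) • v‖
        + 2 * ε * R + 2 * C * (M : ℝ) ^ 2 / R := by
    intro ε hε
    have hev : ∀ᶠ n : ℕ in atTop, ‖u ((n : ℝ)⁻¹) - v‖ < ε := by
      have h1 : Tendsto (fun n : ℕ => (n : ℝ)⁻¹) atTop (𝓝[>] 0) :=
        tendsto_inv_atTop_nhdsGT_zero.comp tendsto_natCast_atTop_atTop
      simpa [dist_eq_norm] using (Metric.tendsto_nhds.1 (hv.comp h1)) ε hε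
    obtain ⟨R₀, hR₀⟩ := eventually_atTop.1 hev
    refine ⟨R₀ + 1, Nat.succ_pos _, fun R hR M hM => ?_⟩
    have hRpos : (0 : ℝ) < R := by exact_mod_cast (by omega : 0 < R)
    have hR1 : (1 : ℝ) ≤ R := by exact_mod_cast (by omega : 1 ≤ R)
    -- With this choice `1 - M * lam = lam * (R - M)`, so homogeneity turns the block estimate into
    -- one between `R • u lam` and `(Φ 1)^[M]` of `(R - M) • u lam`.
    set lam : ℝ := (R : ℝ)⁻¹ with hlam
    have hl0 : 0 < lam := inv_pos.2 hRpos
    have hl1 : lam ≤ 1 := inv_le_one_of_one_le₀ hR1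
    have hRl : (R : ℝ) * lam = 1 := mul_inv_cancel₀ hRpos.ne'
    have hul := hR₀ R (by omega)
    have hfix := hu lam hl0 hl1
    have hnu := h.norm_fixedPoint_le hl0 hl1 hfix
    have hiter : (fun f => Φ lam ((1 - lam) • f))^[M] (u lam) = u lam :=
      Function.iterate_fixed hfix M
    have h1 := h.norm_discounted_iterate_sub_le hl0.le hl1 (u lam) M
    rw [hiter] at h1
    have h2 : ‖u lam - (Φ lam)^[M] ((1 - M * lam) • u lam)‖ ≤ 2 * C * (M * lam) ^ 2 :=
      h1.trans (mul_le_mul_of_nonneg_right (by linarith) (sq_nonneg _))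
    have e1 : (1 - M * lam) • u lam = lam • (((R - M : ℕ) : ℝ) • u lam) := by
      rw [smul_smul, Nat.cast_sub hM]
      congr 1
      linarith
    rw [e1, h.iterate_smul hl0.le] at h2
    have h3 : ‖(R : ℝ) • u lam - (Φ 1)^[M] (((R - M : ℕ) : ℝ) • u lam)‖
        ≤ 2 * C * (M : ℝ) ^ 2 / R := by
      have e2 : (R : ℝ) • u lam - (Φ 1)^[M] (((R - M : ℕ) : ℝ) • u lam)
          = (R : ℝ) • (u lam - lam • (Φ 1)^[M] (((R - M : ℕ) : ℝ) • u lam)) := by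
        rw [smul_sub, smul_smul, hRl, one_smul]
      rw [e2, norm_smul, Real.norm_of_nonneg hRpos.le]
      refine (mul_le_mul_of_nonneg_left h2 hRpos.le).trans (le_of_eq ?_)
      rw [hlam]
      field_simp
    have h4 : ‖(R : ℝ) • u lam - (R : ℝ) • v‖ ≤ R * ε := by
      rw [← smul_sub, norm_smul, Real.norm_of_nonneg hRpos.le]
      exact mul_le_mul_of_nonneg_left hul.le hRpos.le
    have h5 : ‖((R - M : ℕ) : ℝ) • v - ((R - M : ℕ) : ℝ) • u lam‖ ≤ R * ε := by
      rw [← smul_sub, norm_smul, Real.norm_of_nonneg (Nat.cast_nonneg _), norm_sub_rev]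
      exact mul_le_mul (by exact_mod_cast Nat.sub_le R M) hul.le (norm_nonneg _) hRpos.le
    have h6 := h.iterate_nonexpansive 1 M ((Φ 1)^[R - M] 0) (((R - M : ℕ) : ℝ) • u lam)
    rw [← Function.iterate_add_apply, Nat.add_sub_cancel' hM] at h6
    have h7 := norm_sub_le_norm_sub_add_norm_sub ((Φ 1)^[R - M] 0) (((R - M : ℕ) : ℝ) • v)
      (((R - M : ℕ) : ℝ) • u lam)
    have h8 := norm_sub_le_norm_sub_add_norm_sub ((Φ 1)^[R] 0)
      ((Φ 1)^[M] (((R - M : ℕ) : ℝ) • u lam)) ((R : ℝ) • v)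
    have h9 := norm_sub_le_norm_sub_add_norm_sub ((Φ 1)^[M] (((R - M : ℕ) : ℝ) • u lam))
      ((R : ℝ) • u lam) ((R : ℝ) • v)
    rw [norm_sub_rev ((Φ 1)^[M] (((R - M : ℕ) : ℝ) • u lam)) ((R : ℝ) • u lam)] at h9
    linarith
  have hlin : ∀ κ > 0, ∃ A : ℝ, 0 ≤ A ∧ ∀ R : ℕ, ‖(Φ 1)^[R] 0 - (R : ℝ) • v‖ ≤ A + κ * R := by
    intro κ hκ
    -- A block has `δ * R ≤ M ≤ 2 * δ * R`. The quadratic error is then at most `8 * C * δ ^ 2 * R`,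
    -- half of the budget `κ * δ * R ≤ κ * M`; the accuracy `κ * δ / 4` used below spends the other
    -- half.
    obtain ⟨δ, hδ0, hδ1, hδκ⟩ : ∃ δ : ℝ, 0 < δ ∧ δ ≤ 1 / 2 ∧ 8 * C * δ ≤ κ / 2 := by
      refine ⟨min (1 / 2) (κ / (16 * (C + 1))), by positivity, min_le_left _ _, ?_⟩
      have h1 : min (1 / 2) (κ / (16 * (C + 1))) ≤ κ / (16 * (C + 1)) := min_le_right _ _
      have h2 := mul_le_mul_of_nonneg_left h1 (by positivity : 0 ≤ 8 * C)
      refine h2.trans ?_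
      rw [mul_div_assoc', div_le_iff₀ (by positivity)]
      nlinarith
    obtain ⟨R₁, hR₁, hb⟩ := hblock (κ * δ / 4) (by positivity)
    -- For `R ≥ R₂` one has `δ * R ≥ 1`, so rounding `δ * R` up at most doubles it.
    obtain ⟨R₂, hR₂⟩ := exists_nat_ge (1 / δ)
    refine ⟨(C + ‖v‖) * (R₁ + R₂), by positivity, fun R => ?_⟩
    induction R using Nat.strong_induction_on with
    | _ R ih =>
      by_cases hR : R < R₁ + R₂
      · have h1 := h.norm_iterate_zero_le R
        have h2 := _root_.norm_sub_le ((Φ 1)^[R] 0) ((R : ℝ) • v)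
        rw [norm_smul, Real.norm_of_nonneg R.cast_nonneg] at h2
        have h3 : (R : ℝ) ≤ R₁ + R₂ := by exact_mod_cast hR.le
        have h4 : (C + ‖v‖) * R ≤ (C + ‖v‖) * (R₁ + R₂) :=
          mul_le_mul_of_nonneg_left h3 (by positivity)
        have h5 : 0 ≤ κ * R := by positivity
        linarith
      · push Not at hR
        have hR2 : (R₂ : ℝ) ≤ R := by exact_mod_cast (by omega : R₂ ≤ R)
        have hRpos : (0 : ℝ) < R := by exact_mod_cast (by omega : 0 < R)
        have hδR : 1 ≤ δ * R := by
          have := (div_le_iff₀ hδ0).1 (hR₂.trans hR2)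
          linarith
        set M := ⌈δ * R⌉₊ with hM
        have hM1 : δ * R ≤ M := Nat.le_ceil _
        have hM2 : (M : ℝ) ≤ 2 * δ * R := by
          have := Nat.ceil_lt_add_one (by positivity : 0 ≤ δ * R)
          linarith
        have hMR : M ≤ R := by
          have : (M : ℝ) ≤ R := by nlinarith
          exact_mod_cast this
        have hMpos : 0 < M := Nat.ceil_pos.2 (by positivity)
        have h1 := hb R (by omega) M hMR
        have h2 := ih (R - M) (by omega)
        rw [Nat.cast_sub hMR] at h1 h2
        have h3 : 2 * C * (M : ℝ) ^ 2 / R ≤ 8 * C * δ * (δ * R) := by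
          rw [div_le_iff₀ hRpos]
          have : (M : ℝ) ^ 2 ≤ (2 * δ * R) ^ 2 := by gcongr
          nlinarith
        have h4 : 8 * C * δ * (δ * R) ≤ κ / 2 * (δ * R) :=
          mul_le_mul_of_nonneg_right hδκ (by positivity)
        have h5 : κ * (δ * R) ≤ κ * M := mul_le_mul_of_nonneg_left hM1 hκ.le
        linarith
  rw [Metric.tendsto_atTop]
  intro ε hε
  obtain ⟨A, hA, hlin⟩ := hlin (ε / 2) (half_pos hε)
  obtain ⟨N, hN⟩ := exists_nat_gt (2 * A / ε)
  refine ⟨N + 1, fun n hn => ?_⟩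
  have hnpos : (0 : ℝ) < n := by exact_mod_cast (by omega : 0 < n)
  have hnN : (N : ℝ) ≤ n := by exact_mod_cast (by omega : N ≤ n)
  have e1 : (n : ℝ)⁻¹ • (Φ 1)^[n] 0 - v = (n : ℝ)⁻¹ • ((Φ 1)^[n] 0 - (n : ℝ) • v) := by
    rw [smul_sub, smul_smul, inv_mul_cancel₀ hnpos.ne', one_smul]
  rw [dist_eq_norm, e1, norm_smul, Real.norm_of_nonneg (inv_nonneg.2 hnpos.le),
    inv_mul_lt_iff₀ hnpos]
  have h1 := (div_lt_iff₀ hε).1 (hN.trans_le hnN)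
  linarith [hlin n]

/-- If the values of the finitely repeated games are close to `v`, then `v` is almost invariant
under a block of discounted stages. -/
lemma norm_discounted_iterate_self_sub_le (h : IsShapleyOperator Φ C) {lam ε : ℝ} (hl0 : 0 < lam)
    (hl1 : lam ≤ 1) (hε : 0 ≤ ε) {v : X} (hv : lam * ‖v‖ ≤ ε) {M R : ℕ}
    (hN1 : ((M + R : ℕ) : ℝ) * lam ≤ 1) (hN2 : 1 - lam ≤ ((M + R : ℕ) : ℝ) * lam)
    (hR : ‖(Φ 1)^[R] 0 - (R : ℝ) • v‖ ≤ ε * R)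
    (hN : ‖(Φ 1)^[M + R] 0 - ((M + R : ℕ) : ℝ) • v‖ ≤ ε * (M + R : ℕ)) :
    ‖(fun f => Φ lam ((1 - lam) • f))^[M] v - v‖ ≤ 4 * ε + (C + ‖v‖) * (M * lam) ^ 2 := by
  have h1 := h.norm_discounted_iterate_sub_le hl0.le hl1 v M
  have h2 : ‖(Φ lam)^[M] ((1 - M * lam) • v) - (Φ lam)^[M] (lam • (Φ 1)^[R] 0)‖ ≤ 2 * ε := by
    refine (h.iterate_nonexpansive lam M _ _).trans ?_
    rw [norm_sub_rev] at hR
    -- The first term is a rounding error: `(M + R) * lam` lies within `lam` of `1`, so it costs at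
    -- most `lam * ‖v‖ ≤ ε`.
    have e1 : (1 - M * lam) • v - lam • (Φ 1)^[R] 0
        = (1 - ((M + R : ℕ) : ℝ) * lam) • v + lam • ((R : ℝ) • v - (Φ 1)^[R] 0) := by
      push_cast
      module
    rw [e1]
    refine (norm_add_le _ _).trans ?_
    rw [norm_smul, norm_smul, Real.norm_of_nonneg hl0.le, Real.norm_of_nonneg (by linarith)]
    have h4 := mul_le_mul_of_nonneg_left hR hl0.le
    have h5 : lam * (ε * R) ≤ ε := by
      have h6 : R * lam ≤ 1 := by
        have : (0 : ℝ) ≤ M * lam := by positivity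
        push_cast at hN1
        linarith
      linarith [mul_le_mul_of_nonneg_left h6 hε]
    have h6 : (1 - ((M + R : ℕ) : ℝ) * lam) * ‖v‖ ≤ lam * ‖v‖ :=
      mul_le_mul_of_nonneg_right (by linarith) (norm_nonneg v)
    linarith
  have h3 : ‖(Φ lam)^[M] (lam • (Φ 1)^[R] 0) - v‖ ≤ 2 * ε := by
    rw [h.iterate_smul hl0.le, ← Function.iterate_add_apply]
    have e1 : lam • (Φ 1)^[M + R] 0 - v = lam • ((Φ 1)^[M + R] 0 - ((M + R : ℕ) : ℝ) • v)
        - (1 - ((M + R : ℕ) : ℝ) * lam) • v := by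
      module
    rw [e1]
    refine (_root_.norm_sub_le _ _).trans ?_
    rw [norm_smul, norm_smul, Real.norm_of_nonneg hl0.le, Real.norm_of_nonneg (by linarith)]
    have h4 := mul_le_mul_of_nonneg_left hN hl0.le
    have h5 : lam * (ε * (M + R : ℕ)) ≤ ε := by linarith [mul_le_mul_of_nonneg_left hN1 hε]
    have h6 : (1 - ((M + R : ℕ) : ℝ) * lam) * ‖v‖ ≤ lam * ‖v‖ :=
      mul_le_mul_of_nonneg_right (by linarith) (norm_nonneg v)
    linarith
  have h5 := norm_sub_le_norm_sub_add_norm_sub ((fun f => Φ lam ((1 - lam) • f))^[M] v)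
    ((Φ lam)^[M] ((1 - M * lam) • v)) v
  have h6 := norm_sub_le_norm_sub_add_norm_sub ((Φ lam)^[M] ((1 - M * lam) • v))
    ((Φ lam)^[M] (lam • (Φ 1)^[R] 0)) v
  linarith

/-- If the values of the finitely repeated games converge, the discounted values converge to the
same limit. -/
theorem tendsto_discounted (h : IsShapleyOperator Φ C) {u : ℝ → X}
    (hu : ∀ lam, 0 < lam → lam ≤ 1 → Φ lam ((1 - lam) • u lam) = u lam) {v : X}
    (hv : Tendsto (fun n : ℕ => (n : ℝ)⁻¹ • (Φ 1)^[n] 0) atTop (𝓝 v)) :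
    Tendsto u (𝓝[>] 0) (𝓝 v) := by
  have hC := h.nonneg
  have happrox : ∀ ε > 0, ∃ N₀ : ℕ, ∀ R ≥ N₀, ‖(Φ 1)^[R] 0 - (R : ℝ) • v‖ ≤ ε * R := by
    intro ε hε
    obtain ⟨N₀, hN₀⟩ := Metric.tendsto_atTop.1 hv ε hε
    refine ⟨N₀ + 1, fun n hn => ?_⟩
    have hnpos : (0 : ℝ) < n := by exact_mod_cast (by omega : 0 < n)
    have e1 : (n : ℝ)⁻¹ • (Φ 1)^[n] 0 - v = (n : ℝ)⁻¹ • ((Φ 1)^[n] 0 - (n : ℝ) • v) := by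
      rw [smul_sub, smul_smul, inv_mul_cancel₀ hnpos.ne', one_smul]
    have h1 := hN₀ n (by omega)
    rw [dist_eq_norm, e1, norm_smul, Real.norm_of_nonneg (inv_nonneg.2 hnpos.le),
      inv_mul_lt_iff₀ hnpos] at h1
    linarith
  rw [Metric.tendsto_nhdsWithin_nhds]
  intro η hη
  -- With `δ ≤ M * lam ≤ 2 * δ`, this and the choice of `ε` below bound each of the two errors by `M
  -- * lam * (η / 8)`, to be compared with the contraction gain `M * lam / 2`.
  obtain ⟨δ, hδ0, hδ1, hδη⟩ : ∃ δ : ℝ, 0 < δ ∧ δ ≤ 1 / 4 ∧ 4 * (C + ‖v‖) * δ ≤ η / 4 := by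
    refine ⟨min (1 / 4) (η / (16 * (C + ‖v‖ + 1))), by positivity, min_le_left _ _, ?_⟩
    have h1 : min (1 / 4) (η / (16 * (C + ‖v‖ + 1))) ≤ η / (16 * (C + ‖v‖ + 1)) :=
      min_le_right _ _
    have h2 := mul_le_mul_of_nonneg_left h1 (by positivity : 0 ≤ 4 * (C + ‖v‖))
    refine h2.trans ?_
    rw [mul_div_assoc', div_le_iff₀ (by positivity)]
    nlinarith [norm_nonneg v]
  set ε := η * δ / 32 with hε
  have hε0 : 0 < ε := by positivity
  obtain ⟨N₀, hN₀⟩ := happrox ε hε0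
  refine ⟨min δ (min (1 / (2 * (N₀ + 1))) (ε / (‖v‖ + 1))), by positivity, fun lam hl hd => ?_⟩
  have hl0 : 0 < lam := hl
  rw [dist_zero_right, Real.norm_of_nonneg hl0.le, lt_min_iff, lt_min_iff] at hd
  obtain ⟨hlδ, hlN, hlv⟩ := hd
  have hl1 : lam ≤ 1 := by linarith
  have hlv' : lam * ‖v‖ ≤ ε := by
    rw [lt_div_iff₀ (by positivity)] at hlv
    linarith
  set M := ⌈δ / lam⌉₊ with hM
  have hM1 : δ ≤ M * lam := (div_le_iff₀ hl0).1 (Nat.le_ceil _)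
  have hM2 : M * lam ≤ 2 * δ := by
    have h1 := (Nat.ceil_lt_add_one (by positivity : 0 ≤ δ / lam)).le
    have h2 := mul_le_mul_of_nonneg_right h1 hl0.le
    rw [add_mul, div_mul_cancel₀ _ hl0.ne'] at h2
    linarith
  set N := ⌊1 / lam⌋₊ with hN
  have hN1 : N * lam ≤ 1 := (le_div_iff₀ hl0).1 (Nat.floor_le (by positivity))
  have hN2 : 1 - lam ≤ N * lam := by
    have h1 := (Nat.lt_floor_add_one (1 / lam)).le
    have h2 := mul_le_mul_of_nonneg_right h1 hl0.le
    rw [div_mul_cancel₀ _ hl0.ne', add_mul] at h2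
    linarith
  have hlN' : lam * (N₀ + 1) ≤ 1 / 2 := by
    rw [lt_div_iff₀ (by positivity)] at hlN
    linarith
  have hNM : N₀ + M ≤ N := by
    have : ((N₀ + M : ℕ) : ℝ) * lam ≤ N * lam := by
      push_cast
      linarith
    exact_mod_cast le_of_mul_le_mul_right this hl0
  obtain ⟨R, hR⟩ := Nat.exists_eq_add_of_le (by omega : M ≤ N)
  have h4 := h.norm_discounted_iterate_self_sub_le hl0 hl1 hε0.le hlv' (M := M) (R := R)
    (by rwa [← hR]) (by rwa [← hR]) (hN₀ R (by omega)) (by rw [← hR]; exact hN₀ N (by omega))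
  set D : X → X := fun f => Φ lam ((1 - lam) • f) with hD
  have h5 : ‖u lam - D^[M] v‖ ≤ (1 - lam) ^ M * ‖u lam - v‖ := by
    have := h.discounted_iterate_nonexpansive hl1 M (u lam) v
    rwa [Function.iterate_fixed (hu lam hl0 hl1) M] at this
  have h6 := norm_sub_le_norm_sub_add_norm_sub (u lam) (D^[M] v) v
  -- Uses `(1 - lam) ^ M ≤ 1 - M * lam + (M * lam) ^ 2` and `M * lam ≤ 2 * δ ≤ 1 / 2`.
  have h7 : (1 - lam) ^ M ≤ 1 - M * lam / 2 := by
    have h8 := (abs_le.1 (abs_pow_sub_le hl0.le hl1 M)).2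
    nlinarith
  have h8 := mul_le_mul_of_nonneg_right h7 (norm_nonneg (u lam - v))
  have h9 : M * lam / 2 * ‖u lam - v‖ ≤ 4 * ε + (C + ‖v‖) * (M * lam) ^ 2 := by linarith
  have h10 : M * lam / 2 * ‖u lam - v‖ ≤ M * lam / 2 * (η / 2) := by
    refine h9.trans ?_
    have h11 : 4 * ε ≤ M * lam * (η / 8) := by
      rw [hε]
      nlinarith
    have h12 : (C + ‖v‖) * (M * lam) ^ 2 ≤ M * lam * (η / 8) := by
      have h13 : (C + ‖v‖) * (M * lam) ≤ (C + ‖v‖) * (2 * δ) :=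
        mul_le_mul_of_nonneg_left hM2 (by positivity)
      have h14 : 0 ≤ M * lam := by positivity
      nlinarith
    linarith
  have h11 := le_of_mul_le_mul_left h10 (by linarith : 0 < M * lam / 2)
  rw [dist_eq_norm]
  linarith

end IsShapleyOperator

end Tauberian

/-! ### Law of the play and dynamic programming -/

lemma exists_abs_le_of_finite {α : Type*} [Finite α] (f : α → ℝ) : ∃ B, ∀ k, |f k| ≤ B := by
  obtain ⟨B, hB⟩ := (Set.finite_range fun k => |f k|).bddAbove
  exact ⟨B, fun k => hB ⟨k, rfl⟩⟩

namespace StochasticGame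

variable {K I J : Type*} [MeasurableSpace K] [MeasurableSpace I] [MeasurableSpace J]

instance (G : StochasticGame K I J) (k₁ : K) (σ : Strategy K I J I) (τ : Strategy K I J J) :
    IsProbabilityMeasure (G.playMeasure k₁ σ τ) := by
  unfold playMeasure; infer_instance

lemma map_playMeasure_zero (G : StochasticGame K I J) (k₁ : K) (σ : Strategy K I J I)
    (τ : Strategy K I J J) :
    (G.playMeasure k₁ σ τ).map (fun z => z 0) = stageKernel σ τ 0 (Fin.elim0, k₁) := by
  have h1 : (fun z : ℕ → K × I × J => z 0) = (fun h : Finset.Iic 0 → K × I × J =>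
      h ⟨0, Finset.mem_Iic.2 le_rfl⟩) ∘ Preorder.frestrictLe (π := fun _ => K × I × J) 0 := rfl
  rw [h1, ← Measure.map_map (by fun_prop) (by fun_prop), playMeasure, Kernel.trajMeasure,
    Measure.map_comp _ _ (by fun_prop), Kernel.traj_map_frestrictLe, Kernel.partialTraj_self,
    Measure.id_comp, Measure.map_map (by fun_prop) (by fun_prop)]
  exact Measure.map_id

lemma integral_playMeasure_zero (G : StochasticGame K I J) (k₁ : K) (σ : Strategy K I J I)
    (τ : Strategy K I J J) {φ : K × I × J → ℝ} (hφ : Measurable φ) :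
    ∫ z, φ (z 0) ∂(G.playMeasure k₁ σ τ) = ∫ p, φ p ∂(stageKernel σ τ 0 (Fin.elim0, k₁)) := by
  rw [← map_playMeasure_zero G k₁ σ τ,
    integral_map (measurable_pi_apply 0).aemeasurable hφ.aestronglyMeasurable]

/-- Disintegration of the joint law of the past and the next stage along the transition kernel. -/
lemma integral_playMeasure_succ (G : StochasticGame K I J) (k₁ : K) (σ : Strategy K I J I)
    (τ : Strategy K I J J) (m : ℕ) {φ : K × I × J → ℝ} (hφ : Measurable φ) {C : ℝ}
    (hC : ∀ p, |φ p| ≤ C) :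
    ∫ z, φ (z (m + 1)) ∂(G.playMeasure k₁ σ τ) =
      ∫ z, (∫ p, φ p ∂(G.transKernel σ τ m (Preorder.frestrictLe m z)))
        ∂(G.playMeasure k₁ σ τ) := by
  have h1 := Kernel.map_frestrictLe_trajMeasure_compProd_eq_map_trajMeasure
    (X := fun _ : ℕ => K × I × J) (μ₀ := stageKernel σ τ 0 (Fin.elim0, k₁))
    (κ := G.transKernel σ τ) (a := m)
  change (G.playMeasure k₁ σ τ).map _ ⊗ₘ _ = (G.playMeasure k₁ σ τ).map _ at h1
  have h2 : ∫ z, φ (z (m + 1)) ∂(G.playMeasure k₁ σ τ) = ∫ y, φ y.2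
      ∂((G.playMeasure k₁ σ τ).map fun x => (Preorder.frestrictLe m x, x (m + 1))) := by
    rw [integral_map (f := fun y : (Finset.Iic m → K × I × J) × K × I × J => φ y.2) (by fun_prop)
      (hφ.comp measurable_snd).aestronglyMeasurable]
  have : IsProbabilityMeasure ((G.playMeasure k₁ σ τ).map
      (Preorder.frestrictLe (π := fun _ => K × I × J) m)) :=
    Measure.isProbabilityMeasure_map (by fun_prop)
  rw [h2, ← h1, Measure.integral_compProd
    (f := fun y : (Finset.Iic m → K × I × J) × K × I × J => φ y.2) (integrable_of_measurable_of_abs_le (hφ.comp measurable_snd) fun y => hC y.2),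
    integral_map (by fun_prop)]
  exact hφ.stronglyMeasurable.integral_kernel.aestronglyMeasurable

lemma integral_transKernel (G : StochasticGame K I J) (σ : Strategy K I J I)
    (τ : Strategy K I J J) (m : ℕ) (h : Finset.Iic m → K × I × J) {φ : K × I × J → ℝ}
    (hφ : Measurable φ) {C : ℝ} (hC : ∀ p, |φ p| ≤ C) :
    ∫ p, φ p ∂(G.transKernel σ τ m h) =
      ∫ k, (∫ p, φ p ∂(stageKernel σ τ (m + 1) (past m h, k)))
        ∂(G.q (h ⟨m, Finset.mem_Iic.2 le_rfl⟩)) := by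
  rw [transKernel, Kernel.comap_apply,
    Kernel.integral_comp (integrable_of_measurable_of_abs_le hφ hC), histKernel, Kernel.prod_apply,
    Kernel.id_apply, Kernel.comap_apply, Measure.dirac_prod, integral_map (by fun_prop)]
  · rfl
  · exact hφ.stronglyMeasurable.integral_kernel.aestronglyMeasurable

lemma integral_stageKernel (σ : Strategy K I J I) (τ : Strategy K I J J) (m : ℕ)
    (h : Hist K I J m) {φ : K × I × J → ℝ} (hφ : Measurable φ) :
    ∫ p, φ p ∂(stageKernel σ τ m h) = ∫ a, φ (h.2, a) ∂((σ.act m h).prod (τ.act m h)) := by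
  rw [stageKernel, Kernel.prod_apply, Kernel.prod_apply, Kernel.deterministic_apply,
    Measure.dirac_prod, integral_map (by fun_prop) hφ.aestronglyMeasurable]

/-- The payoff when the current stage has weight `w` and payoff function `r`, and the continuation
payoff is `f`. -/
noncomputable def oneShot (G : StochasticGame K I J) (r : K × I × J → ℝ) (w : ℝ) (f : K → ℝ)
    (z : K × I × J) : ℝ :=
  w * r z + ∫ k, f k ∂(G.q z)

lemma abs_oneShot_le (G : StochasticGame K I J) {r : K × I × J → ℝ} {C B : ℝ}
    (hC : ∀ z, |r z| ≤ C) {f : K → ℝ} (hB : ∀ k, |f k| ≤ B) (w : ℝ) (z : K × I × J) :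
    |G.oneShot r w f z| ≤ |w| * C + B := by
  refine (abs_add_le _ _).trans (add_le_add ?_ (abs_integral_le_of_abs_le hB))
  rw [abs_mul]
  exact mul_le_mul_of_nonneg_left (hC z) (abs_nonneg w)

variable [Finite K] [MeasurableSingletonClass K]

lemma measurable_integral_q (G : StochasticGame K I J) (f : K → ℝ) :
    Measurable fun z => ∫ k, f k ∂(G.q z) :=
  ((measurable_of_finite f).stronglyMeasurable.integral_kernel (κ := G.q)).measurable

lemma measurable_oneShot (G : StochasticGame K I J) {r : K × I × J → ℝ} (hr : Measurable r)
    (w : ℝ) (f : K → ℝ) : Measurable (G.oneShot r w f) :=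
  (hr.const_mul w).add (G.measurable_integral_q f)

/-- Dynamic programming: if the strategies keep, up to `ε`, the expected continuation payoff above
`f m` at every stage `m`, they guarantee `f 0` up to the accumulated errors and the final
continuation payoff. -/
theorem le_sum_integral_of_le_oneShot (G : StochasticGame K I J) (k₁ : K)
    (σ : Strategy K I J I) (τ : Strategy K I J J) {r : K × I × J → ℝ} (hr : Measurable r) {C : ℝ}
    (hC : ∀ z, |r z| ≤ C) (w : ℕ → ℝ) (f : ℕ → K → ℝ) {ε : ℝ}
    (hf : ∀ m (h : Hist K I J m),
      f m h.2 - ε ≤ ∫ p, G.oneShot r (w m) (f (m + 1)) p ∂(stageKernel σ τ m h)) (N : ℕ) :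
    f 0 k₁ - (N + 1) * ε ≤ ∑ m ∈ Finset.range (N + 1), w m * ∫ z, r (z m) ∂(G.playMeasure k₁ σ τ)
      + ∫ z, ∫ k, f (N + 1) k ∂(G.q (z N)) ∂(G.playMeasure k₁ σ τ) := by
  have hsplit : ∀ m, ∫ z, G.oneShot r (w m) (f (m + 1)) (z m) ∂(G.playMeasure k₁ σ τ)
      = w m * ∫ z, r (z m) ∂(G.playMeasure k₁ σ τ)
        + ∫ z, ∫ k, f (m + 1) k ∂(G.q (z m)) ∂(G.playMeasure k₁ σ τ) := by
    intro m
    obtain ⟨B, hB⟩ := exists_abs_le_of_finite (f (m + 1))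
    unfold oneShot
    rw [integral_add, integral_const_mul]
    · exact (integrable_of_measurable_of_abs_le (f := fun z : ℕ → K × I × J => r (z m))
        (hr.comp (measurable_pi_apply m)) fun z => hC (z m)).const_mul _
    · exact integrable_of_measurable_of_abs_le
        ((G.measurable_integral_q _).comp (measurable_pi_apply m))
        fun z => abs_integral_le_of_abs_le hB
  induction N with
  | zero =>
    have h1 := hf 0 (Fin.elim0, k₁)
    rw [← integral_playMeasure_zero G k₁ σ τ (G.measurable_oneShot hr _ _), hsplit 0] at h1
    simpa using h1
  | succ N ih =>
    obtain ⟨B, hB⟩ := exists_abs_le_of_finite (f (N + 1))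
    obtain ⟨B', hB'⟩ := exists_abs_le_of_finite (f (N + 1 + 1))
    have hm := G.measurable_oneShot hr (w (N + 1)) (f (N + 1 + 1))
    have hb := G.abs_oneShot_le hC hB' (w (N + 1))
    -- Condition on the first `N + 1` stages, draw the new state from `q`, and apply `hf` to each
    -- resulting history.
    have h1 : ∫ z, ∫ k, f (N + 1) k ∂(G.q (z N)) ∂(G.playMeasure k₁ σ τ) - ε
        ≤ ∫ z, G.oneShot r (w (N + 1)) (f (N + 1 + 1)) (z (N + 1))
          ∂(G.playMeasure k₁ σ τ) := by
      rw [integral_playMeasure_succ G k₁ σ τ N hm hb]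
      have h2 : Integrable (fun z : ℕ → K × I × J => ∫ k, f (N + 1) k ∂(G.q (z N)))
          (G.playMeasure k₁ σ τ) :=
        integrable_of_measurable_of_abs_le
          ((G.measurable_integral_q _).comp (measurable_pi_apply N))
          fun z => abs_integral_le_of_abs_le hB
      have h3 : ∫ z, ∫ k, f (N + 1) k ∂(G.q (z N)) ∂(G.playMeasure k₁ σ τ) - ε
          = ∫ z, (∫ k, f (N + 1) k ∂(G.q (z N)) - ε) ∂(G.playMeasure k₁ σ τ) := by
        rw [integral_sub h2 (integrable_const ε)]
        simp
      rw [h3]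
      refine integral_mono (h2.sub (integrable_const ε)) ?_ fun z => ?_
      · exact integrable_of_measurable_of_abs_le
          (hm.stronglyMeasurable.integral_kernel.measurable.comp
            (Preorder.measurable_frestrictLe N))
          fun z => abs_integral_le_of_abs_le hb
      · rw [integral_transKernel G σ τ N _ hm hb]
        have h4 : ∫ k, f (N + 1) k ∂(G.q (z N)) - ε
            = ∫ k, (f (N + 1) k - ε) ∂(G.q (z N)) := by
          rw [integral_sub (integrable_of_measurable_of_abs_le (measurable_of_finite _) hB)
            (integrable_const ε)]
          simp
        change ∫ k, f (N + 1) k ∂(G.q (z N)) - ε ≤ _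
        rw [h4]
        refine integral_mono ?_ ?_ fun k => hf (N + 1) (past N (Preorder.frestrictLe N z), k)
        · exact (integrable_of_measurable_of_abs_le (measurable_of_finite _) hB).sub
            (integrable_const ε)
        · exact integrable_of_measurable_of_abs_le (measurable_of_finite _)
            fun k => abs_integral_le_of_abs_le hb
    rw [hsplit] at h1
    rw [Finset.sum_range_succ]
    push_cast at ih ⊢
    linarith

/-- The strategy which plays the mixed action `x m k` in state `k` at stage `m`. -/
noncomputable def Strategy.markov {A : Type*} [MeasurableSpace A]
    (x : ℕ → K → ProbabilityMeasure A) : Strategy K I J A where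
  act m := (Kernel.ofFunOfCountable fun k => (x m k : Measure A)).comap Prod.snd measurable_snd
  isMarkovKernel_act m := by
    have : IsMarkovKernel (Kernel.ofFunOfCountable fun k => (x m k : Measure A)) :=
      ⟨fun k => inferInstanceAs (IsProbabilityMeasure (x m k : Measure A))⟩
    infer_instance

lemma le_integral_stageKernel_markov {x : ℕ → K → ProbabilityMeasure I} {m : ℕ}
    {φ : K × I × J → ℝ} (hφ : Measurable φ) {C : ℝ} (hC : ∀ p, |φ p| ≤ C) {c : K → ℝ}
    (hx : ∀ k j, c k ≤ ∫ i, φ (k, i, j) ∂(x m k : Measure I)) (τ : Strategy K I J J)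
    (h : Hist K I J m) : c h.2 ≤ ∫ p, φ p ∂(stageKernel (Strategy.markov x) τ m h) := by
  have hint : Integrable (fun a => φ (h.2, a))
      (((Strategy.markov (I := I) (J := J) x).act m h).prod (τ.act m h)) :=
    integrable_of_measurable_of_abs_le (hφ.comp measurable_prodMk_left) fun a => hC (h.2, a)
  rw [integral_stageKernel _ _ _ _ hφ, integral_prod_symm _ hint]
  exact le_integral_of_le hint.integral_prod_right (hx h.2)

lemma integral_stageKernel_markov_le {y : ℕ → K → ProbabilityMeasure J} {m : ℕ}
    {φ : K × I × J → ℝ} (hφ : Measurable φ) {C : ℝ} (hC : ∀ p, |φ p| ≤ C) {c : K → ℝ}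
    (hy : ∀ k i, ∫ j, φ (k, i, j) ∂(y m k : Measure J) ≤ c k) (σ : Strategy K I J I)
    (h : Hist K I J m) : ∫ p, φ p ∂(stageKernel σ (Strategy.markov y) m h) ≤ c h.2 := by
  have hint : Integrable (fun a => φ (h.2, a))
      ((σ.act m h).prod ((Strategy.markov (I := I) (J := J) y).act m h)) :=
    integrable_of_measurable_of_abs_le (hφ.comp measurable_prodMk_left) fun a => hC (h.2, a)
  rw [integral_stageKernel _ _ _ _ hφ, integral_prod _ hint]
  exact integral_le_of_le hint.integral_prod_left (hy h.2)

/-- If `f m` is the value of the one-shot games with continuation payoff `f (m + 1)` for all `m`,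
both players can guarantee `f 0` in the game where stage `m` has weight `w m`, up to the final
continuation payoff. -/
theorem exists_strategies (G : StochasticGame K I J) (w : ℕ → ℝ) (f : ℕ → K → ℝ)
    (hf : ∀ m k, IsMixedValue (fun i j => G.oneShot G.g (w m) (f (m + 1)) (k, i, j)) (f m k))
    (N : ℕ) {B : ℝ} (hB : ∀ k, |f (N + 1) k| ≤ B) {ε : ℝ} (hε : 0 < ε) :
    (∃ σ : Strategy K I J I, ∀ (τ : Strategy K I J J) k₁, f 0 k₁ - B - ε ≤
      ∑ m ∈ Finset.range (N + 1), w m * ∫ z, G.g (z m) ∂(G.playMeasure k₁ σ τ)) ∧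
    ∃ τ : Strategy K I J J, ∀ (σ : Strategy K I J I) k₁,
      ∑ m ∈ Finset.range (N + 1), w m * ∫ z, G.g (z m) ∂(G.playMeasure k₁ σ τ)
        ≤ f 0 k₁ + B + ε := by
  obtain ⟨C, hC⟩ := G.bounded_g
  have hN : (0 : ℝ) < N + 1 := by positivity
  have hε' : 0 < ε / (N + 1) := by positivity
  have hεN : (N + 1) * (ε / (N + 1)) = ε := mul_div_cancel₀ _ hN.ne'
  have hm : ∀ m, Measurable (G.oneShot G.g (w m) (f (m + 1))) :=
    fun m => G.measurable_oneShot G.measurable_g _ _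
  -- Allowing an error `ε / (N + 1)` at each of the `N + 1` stages makes the total `ε`.
  choose x hx using fun m k => (hf m k _ hε').1
  choose y hy using fun m k => (hf m k _ hε').2
  refine ⟨⟨Strategy.markov x, fun τ k₁ => ?_⟩, Strategy.markov y, fun σ k₁ => ?_⟩
  · have h1 := G.le_sum_integral_of_le_oneShot k₁ (Strategy.markov x) τ G.measurable_g hC w f
      (ε := ε / (N + 1)) (fun m h => by
        obtain ⟨B', hB'⟩ := exists_abs_le_of_finite (f (m + 1))
        exact le_integral_stageKernel_markov (c := fun k => f m k - ε / (N + 1)) (hm m)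
          (G.abs_oneShot_le hC hB' (w m)) (hx m) τ h) N
    have h2 : |∫ z, ∫ k, f (N + 1) k ∂(G.q (z N))
        ∂(G.playMeasure k₁ (Strategy.markov x) τ)| ≤ B :=
      abs_integral_le_of_abs_le fun z => abs_integral_le_of_abs_le hB
    rw [hεN] at h1
    linarith [(abs_le.1 h2).2]
  -- Player 2's guarantee is the same estimate for the payoff `-g` and the continuation payoffs `-f
  -- m`.
  · have h1 := G.le_sum_integral_of_le_oneShot k₁ σ (Strategy.markov y) (r := fun z => -G.g z)
      G.measurable_g.neg (C := C) (fun z => by rw [abs_neg]; exact hC z) w (fun m k => -f m k)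
      (ε := ε / (N + 1)) (fun m h => by
        obtain ⟨B', hB'⟩ := exists_abs_le_of_finite (f (m + 1))
        have h2 := integral_stageKernel_markov_le (c := fun k => f m k + ε / (N + 1)) (hm m)
          (G.abs_oneShot_le hC hB' (w m)) (hy m) σ h
        have h3 : G.oneShot (fun z => -G.g z) (w m) (fun k => -f (m + 1) k)
            = fun p => -G.oneShot G.g (w m) (f (m + 1)) p := by
          funext p
          simp only [oneShot, integral_neg]
          ring
        rw [h3, integral_neg]
        linarith) N
    have h2 : |∫ z, ∫ k, -f (N + 1) k ∂(G.q (z N))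
        ∂(G.playMeasure k₁ σ (Strategy.markov y))| ≤ B :=
      abs_integral_le_of_abs_le fun z => abs_integral_le_of_abs_le fun k => by
        rw [abs_neg]; exact hB k
    simp only [integral_neg, mul_neg, Finset.sum_neg_distrib] at h1 h2
    rw [hεN] at h1
    rw [abs_neg] at h2
    linarith [(abs_le.1 h2).1]

end StochasticGame

/-! ### Values of the finite and discounted games -/

namespace StochasticGame

/-- A bounded game has the value `c` if both players can guarantee `c` up to `ε`. -/
lemma hasValue_and_value_eq {S T : Type*} {γ : S → T → ℝ} {B c : ℝ} (hB : ∀ σ τ, |γ σ τ| ≤ B)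
    (h₁ : ∀ ε > 0, ∃ σ, ∀ τ, c - ε ≤ γ σ τ) (h₂ : ∀ ε > 0, ∃ τ, ∀ σ, γ σ τ ≤ c + ε) :
    HasValue γ ∧ value γ = c := by
  have : Nonempty S := ⟨(h₁ 1 one_pos).choose⟩
  have : Nonempty T := ⟨(h₂ 1 one_pos).choose⟩
  have hbelow : ∀ σ, BddBelow (Set.range fun τ => γ σ τ) := fun σ =>
    ⟨-B, by rintro _ ⟨τ, rfl⟩; exact (abs_le.1 (hB σ τ)).1⟩
  have habove : ∀ τ, BddAbove (Set.range fun σ => γ σ τ) := fun τ =>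
    ⟨B, by rintro _ ⟨σ, rfl⟩; exact (abs_le.1 (hB σ τ)).2⟩
  have habove' : BddAbove (Set.range fun σ => ⨅ τ, γ σ τ) := by
    refine ⟨B, ?_⟩
    rintro _ ⟨σ, rfl⟩
    exact (ciInf_le (hbelow σ) (Classical.arbitrary T)).trans (abs_le.1 (hB σ _)).2
  have hbelow' : BddBelow (Set.range fun τ => ⨆ σ, γ σ τ) := by
    refine ⟨-B, ?_⟩
    rintro _ ⟨τ, rfl⟩
    exact (abs_le.1 (hB _ τ)).1.trans (le_ciSup (habove τ) (Classical.arbitrary S))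
  have hsup : ⨆ σ, ⨅ τ, γ σ τ = c := by
    refine le_antisymm (le_of_forall_pos_le_add fun ε hε => ?_)
      (le_of_forall_pos_le_add fun ε hε => ?_)
    · obtain ⟨τ, hτ⟩ := h₂ ε hε
      exact ciSup_le fun σ => (ciInf_le (hbelow σ) τ).trans (hτ σ)
    · obtain ⟨σ, hσ⟩ := h₁ ε hε
      have := (le_ciInf hσ).trans (le_ciSup habove' σ)
      linarith
  have hinf : ⨅ τ, ⨆ σ, γ σ τ = c := by
    refine le_antisymm (le_of_forall_pos_le_add fun ε hε => ?_)
      (le_of_forall_pos_le_add fun ε hε => ?_)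
    · obtain ⟨τ, hτ⟩ := h₂ ε hε
      exact (ciInf_le hbelow' τ).trans (ciSup_le hτ)
    · obtain ⟨σ, hσ⟩ := h₁ ε hε
      have : c - ε ≤ ⨅ τ, ⨆ σ, γ σ τ := le_ciInf fun τ => (hσ τ).trans (le_ciSup (habove τ) σ)
      linarith
  exact ⟨hsup.trans hinf.symm, hsup⟩

section Payoff

variable {K I J : Type*} [MeasurableSpace K] [MeasurableSpace I] [MeasurableSpace J]

lemma integrable_g (G : StochasticGame K I J) (m : ℕ) (μ : Measure (ℕ → K × I × J))
    [IsFiniteMeasure μ] : Integrable (fun z => G.g (z m)) μ := by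
  obtain ⟨C, hC⟩ := G.bounded_g
  exact integrable_of_measurable_of_abs_le (f := fun z : ℕ → K × I × J => G.g (z m))
    (G.measurable_g.comp (measurable_pi_apply m)) fun z => hC (z m)

lemma stagePayoff_eq (G : StochasticGame K I J) (n : ℕ) (k₁ : K) (σ : Strategy K I J I)
    (τ : Strategy K I J J) :
    G.stagePayoff n k₁ σ τ =
      ∑ m ∈ Finset.range n, (n : ℝ)⁻¹ * ∫ z, G.g (z m) ∂(G.playMeasure k₁ σ τ) := by
  rw [stagePayoff, integral_const_mul, integral_finsetSum _ fun m _ => G.integrable_g m _,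
    Finset.mul_sum]

lemma abs_stagePayoff_le (G : StochasticGame K I J) {C : ℝ} (hC : ∀ z, |G.g z| ≤ C) {n : ℕ}
    (hn : 1 ≤ n) (k₁ : K) (σ : Strategy K I J I) (τ : Strategy K I J J) :
    |G.stagePayoff n k₁ σ τ| ≤ C := by
  have hn' : (0 : ℝ) < n := by exact_mod_cast hn
  refine abs_integral_le_of_abs_le fun z => ?_
  rw [abs_mul, abs_of_nonneg (inv_nonneg.2 hn'.le), inv_mul_le_iff₀ hn']
  refine (Finset.abs_sum_le_sum_abs _ _).trans ((Finset.sum_le_sum fun m _ => hC (z m)).trans ?_)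
  simp

/-- The series can be integrated termwise, and the weights from stage `N` on sum to `(1 - lam) ^ N`.
-/
lemma abs_discountedPayoff_sub_le (G : StochasticGame K I J) {C : ℝ} (hC : ∀ z, |G.g z| ≤ C)
    {lam : ℝ} (h0 : 0 < lam) (h1 : lam ≤ 1) (k₁ : K) (σ : Strategy K I J I)
    (τ : Strategy K I J J) (N : ℕ) :
    |G.discountedPayoff lam k₁ σ τ - ∑ m ∈ Finset.range N,
      lam * (1 - lam) ^ m * ∫ z, G.g (z m) ∂(G.playMeasure k₁ σ τ)| ≤ (1 - lam) ^ N * C := by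
  have hl : 0 ≤ 1 - lam := by linarith
  have hgeom : HasSum (fun m => lam * (1 - lam) ^ m) 1 := by
    have := (hasSum_geometric_of_lt_one hl (by linarith)).mul_left lam
    rwa [sub_sub_cancel, mul_inv_cancel₀ h0.ne'] at this
  have hE : ∀ m, |∫ z, G.g (z m) ∂(G.playMeasure k₁ σ τ)| ≤ C := fun m =>
    abs_integral_le_of_abs_le fun z => hC (z m)
  have hint : ∀ m, Integrable (fun z => lam * (1 - lam) ^ m * G.g (z m))
      (G.playMeasure k₁ σ τ) := fun m => (G.integrable_g m _).const_mul _
  have hsum : HasSum (fun m => lam * (1 - lam) ^ m * ∫ z, G.g (z m) ∂(G.playMeasure k₁ σ τ))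
      (G.discountedPayoff lam k₁ σ τ) := by
    have h2 := hasSum_integral_of_summable_integral_norm hint (by
      refine Summable.of_nonneg_of_le (fun m => integral_nonneg fun z => norm_nonneg _)
        (fun m => ?_) (hgeom.mul_right C).summable
      refine integral_le_of_le (hint m).norm fun z => ?_
      rw [norm_mul, Real.norm_of_nonneg (by positivity)]
      exact mul_le_mul_of_nonneg_left (hC (z m)) (by positivity))
    simp only [integral_const_mul] at h2
    exact h2
  rw [← hsum.tsum_eq, ← hsum.summable.sum_add_tsum_nat_add N, add_sub_cancel_left]
  have htail : HasSum (fun m => (1 - lam) ^ N * (lam * (1 - lam) ^ m * C)) ((1 - lam) ^ N * C) := by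
    simpa using (hgeom.mul_right C).mul_left ((1 - lam) ^ N)
  rw [← Real.norm_eq_abs]
  refine tsum_of_norm_bounded htail fun m => ?_
  rw [norm_mul, Real.norm_of_nonneg (by positivity), pow_add]
  calc lam * ((1 - lam) ^ m * (1 - lam) ^ N) * ‖∫ z, G.g (z (m + N)) ∂(G.playMeasure k₁ σ τ)‖
      ≤ lam * ((1 - lam) ^ m * (1 - lam) ^ N) * C :=
        mul_le_mul_of_nonneg_left (hE (m + N)) (by positivity)
    _ = (1 - lam) ^ N * (lam * (1 - lam) ^ m * C) := by ring

end Payoff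

section Shapley

variable {K I J : Type*} [MeasurableSpace K] [MeasurableSpace I] [MeasurableSpace J]

lemma measurable_uncurry_oneShot [Finite K] [MeasurableSingletonClass K]
    (G : StochasticGame K I J) (w : ℝ) (f : K → ℝ) (k : K) :
    Measurable (Function.uncurry fun i j => G.oneShot G.g w f (k, i, j)) :=
  (G.measurable_oneShot G.measurable_g w f).comp measurable_prodMk_left

lemma oneShot_mul (G : StochasticGame K I J) (s w : ℝ) (f : K → ℝ) (z : K × I × J) :
    G.oneShot G.g (s * w) (s • f) z = s * G.oneShot G.g w f z := by
  simp only [oneShot, Pi.smul_apply, smul_eq_mul, integral_const_mul]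
  ring

lemma oneShot_le_add [Fintype K] [MeasurableSingletonClass K] (G : StochasticGame K I J) {C : ℝ}
    (hC : ∀ z, |G.g z| ≤ C) (w w' : ℝ) (f f' : K → ℝ) (z : K × I × J) :
    G.oneShot G.g w f z ≤ G.oneShot G.g w' f' z + (C * |w - w'| + ‖f - f'‖) := by
  have h1 : (w - w') * G.g z ≤ C * |w - w'| := by
    refine (le_abs_self _).trans ?_
    rw [abs_mul, mul_comm]
    exact mul_le_mul_of_nonneg_right (hC z) (abs_nonneg _)
  have hint : ∀ f : K → ℝ, Integrable f (G.q z) := fun f => by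
    obtain ⟨B, hB⟩ := exists_abs_le_of_finite f
    exact integrable_of_measurable_of_abs_le (measurable_of_finite f) hB
  have h2 : ∫ k, f k ∂(G.q z) - ∫ k, f' k ∂(G.q z) ≤ ‖f - f'‖ := by
    rw [← integral_sub (hint f) (hint f')]
    exact integral_le_of_le ((hint f).sub (hint f')) fun k =>
      (le_abs_self _).trans (norm_le_pi_norm (f - f') k)
  simp only [oneShot]
  linarith

/-- The values of the one-shot games form a Shapley operator. -/
lemma isShapleyOperator_of_isMixedValue [Fintype K] [MeasurableSingletonClass K]
    (G : StochasticGame K I J) {C : ℝ} (hC0 : 0 ≤ C) (hC : ∀ z, |G.g z| ≤ C)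
    {Φ : ℝ → (K → ℝ) → K → ℝ}
    (hΦ : ∀ w f k, IsMixedValue (fun i j => G.oneShot G.g w f (k, i, j)) (Φ w f k)) :
    IsShapleyOperator Φ C := by
  have hb : ∀ w (f : K → ℝ), ∃ B, ∀ z, |G.oneShot G.g w f z| ≤ B := fun w f => by
    obtain ⟨B, hB⟩ := exists_abs_le_of_finite f
    exact ⟨_, G.abs_oneShot_le hC hB w⟩
  have hle : ∀ w w' f f' k, Φ w f k ≤ Φ w' f' k + (C * |w - w'| + ‖f - f'‖) := by
    intro w w' f f' k
    obtain ⟨B, hB⟩ := hb w f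
    obtain ⟨B', hB'⟩ := hb w' f'
    exact (hΦ w f k).le_add (hΦ w' f' k) (G.measurable_uncurry_oneShot w f k)
      (G.measurable_uncurry_oneShot w' f' k) (fun i j => hB (k, i, j)) (fun i j => hB' (k, i, j))
      fun i j => G.oneShot_le_add hC w w' f f' (k, i, j)
  refine ⟨hC0, fun w w' f f' => ?_, fun s hs w f => funext fun k => ?_⟩
  · rw [pi_norm_le_iff_of_nonneg (by positivity)]
    intro k
    rw [Pi.sub_apply, Real.norm_eq_abs, abs_sub_le_iff]
    have h1 := hle w' w f' f k
    rw [abs_sub_comm, norm_sub_rev] at h1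
    constructor <;> linarith [hle w w' f f' k]
  · obtain ⟨B, hB⟩ := hb (s * w) (s • f)
    have h1 := (hΦ w f k).const_mul hs
    simp only [← oneShot_mul] at h1
    have h2 := hΦ (s * w) (s • f) k
    have hm := G.measurable_uncurry_oneShot (s * w) (s • f) k
    have hbd : ∀ i j, |G.oneShot G.g (s * w) (s • f) (k, i, j)| ≤ B := fun i j => hB (k, i, j)
    -- Both sides are values of the same game, and the value is unique.
    refine le_antisymm ?_ ?_
    · simpa using h2.le_add h1 hm hm hbd hbd (d := 0) fun i j => by simp
    · simpa using h1.le_add h2 hm hm hbd hbd (d := 0) fun i j => by simp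

/-- On a finite discrete `K` every `f` is bounded and continuous, so weak-* continuity of the
transition applies to it. -/
lemma continuous_oneShot_left [Finite K] [TopologicalSpace K] [DiscreteTopology K] [BorelSpace K]
    [TopologicalSpace I] [TopologicalSpace J] {G : StochasticGame K I J}
    (hG : G.SeparatelyContinuous) (w : ℝ) (f : K → ℝ) (k : K) (j : J) :
    Continuous fun i => G.oneShot G.g w f (k, i, j) := by
  have : CompactSpace K := Finite.compactSpace
  refine ((hG.g_left k j).const_mul w).add ?_
  exact (ProbabilityMeasure.continuous_integral_boundedContinuousFunction
    (BoundedContinuousFunction.mkOfCompact ⟨f, continuous_of_discreteTopology⟩)).comp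
    (hG.q_left k j)

lemma hasValue_stagePayoff [Fintype K] [MeasurableSingletonClass K]
    (G : StochasticGame K I J) {C : ℝ} (hC : ∀ z, |G.g z| ≤ C)
    {Φ : ℝ → (K → ℝ) → K → ℝ} (h : IsShapleyOperator Φ C)
    (hΦ : ∀ w f k, IsMixedValue (fun i j => G.oneShot G.g w f (k, i, j)) (Φ w f k))
    {n : ℕ} (hn : 1 ≤ n) (k₁ : K) :
    HasValue (G.stagePayoff n k₁) ∧ G.stageValue n k₁ = ((n : ℝ)⁻¹ • (Φ 1)^[n] 0) k₁ := by
  set w : ℕ → ℝ := fun m => if m < n then (n : ℝ)⁻¹ else 0 with hw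
  -- Truncated subtraction makes `f m = 0` for `m ≥ n`, consistent with the zero weights there since
  -- `Φ 0 0 = 0`; the final continuation payoff therefore vanishes.
  set f : ℕ → K → ℝ := fun m => (n : ℝ)⁻¹ • (Φ 1)^[n - m] 0 with hf
  have hrec : ∀ m, Φ (w m) (f (m + 1)) = f m := by
    intro m
    by_cases hm : m < n
    · have h1 := h.smul (n : ℝ)⁻¹ (by positivity) 1 ((Φ 1)^[n - (m + 1)] 0)
      rw [mul_one, ← Function.iterate_succ_apply' (Φ 1), show (n - (m + 1)).succ = n - m by omega]
        at h1
      simpa [hw, hf, hm] using h1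
    · have h1 : n - (m + 1) = 0 := by omega
      have h2 : n - m = 0 := by omega
      simp [hw, hf, hm, h1, h2, h.map_zero]
  have hmv : ∀ m k, IsMixedValue (fun i j => G.oneShot G.g (w m) (f (m + 1)) (k, i, j)) (f m k) :=
    fun m k => by rw [← hrec m]; exact hΦ _ _ k
  obtain ⟨N, rfl⟩ := Nat.exists_eq_add_of_le' hn
  have hN : ∀ k, |f (N + 1) k| ≤ 0 := fun k => by simp [hf]
  have hpay : ∀ σ τ, G.stagePayoff (N + 1) k₁ σ τ = ∑ m ∈ Finset.range (N + 1),
      w m * ∫ z, G.g (z m) ∂(G.playMeasure k₁ σ τ) := fun σ τ => by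
    rw [stagePayoff_eq]
    refine Finset.sum_congr rfl fun m hm => ?_
    simp only [hw, if_pos (Finset.mem_range.1 hm)]
  refine hasValue_and_value_eq (G.abs_stagePayoff_le hC hn k₁) (fun ε hε => ?_) fun ε hε => ?_
  · obtain ⟨σ, hσ⟩ := (G.exists_strategies w f hmv N hN hε).1
    refine ⟨σ, fun τ => ?_⟩
    rw [hpay]
    simpa [hf] using hσ τ k₁
  · obtain ⟨τ, hτ⟩ := (G.exists_strategies w f hmv N hN hε).2
    refine ⟨τ, fun σ => ?_⟩
    rw [hpay]
    simpa [hf] using hτ σ k₁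

lemma hasValue_discountedPayoff [Fintype K] [MeasurableSingletonClass K]
    (G : StochasticGame K I J) {C : ℝ} (hC : ∀ z, |G.g z| ≤ C)
    {Φ : ℝ → (K → ℝ) → K → ℝ} (h : IsShapleyOperator Φ C)
    (hΦ : ∀ w f k, IsMixedValue (fun i j => G.oneShot G.g w f (k, i, j)) (Φ w f k))
    {lam : ℝ} (h0 : 0 < lam) (h1 : lam ≤ 1) {u : K → ℝ} (hu : Φ lam ((1 - lam) • u) = u)
    (k₁ : K) :
    HasValue (G.discountedPayoff lam k₁) ∧ G.discountedValue lam k₁ = u k₁ := by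
  have hl : 0 ≤ 1 - lam := by linarith
  set w : ℕ → ℝ := fun m => lam * (1 - lam) ^ m with hw
  -- Homogeneity propagates the fixed-point equation to all stages, and the final continuation
  -- payoff decays geometrically.
  set f : ℕ → K → ℝ := fun m => (1 - lam) ^ m • u with hf
  have hrec : ∀ m, Φ (w m) (f (m + 1)) = f m := by
    intro m
    have h2 := h.smul ((1 - lam) ^ m) (by positivity) lam ((1 - lam) • u)
    rwa [hu, smul_smul, ← pow_succ, mul_comm _ lam] at h2
  have hmv : ∀ m k, IsMixedValue (fun i j => G.oneShot G.g (w m) (f (m + 1)) (k, i, j)) (f m k) :=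
    fun m k => by rw [← hrec m]; exact hΦ _ _ k
  have hbound : ∀ N k, |f N k| ≤ (1 - lam) ^ N * C := by
    intro N k
    simp only [hf, Pi.smul_apply, smul_eq_mul]
    rw [abs_mul, abs_of_nonneg (by positivity)]
    exact mul_le_mul_of_nonneg_left
      ((norm_le_pi_norm u k).trans (h.norm_fixedPoint_le h0 h1 hu)) (by positivity)
  have hsmall : ∀ ε > 0, ∃ N, (1 - lam) ^ (N + 1) * C ≤ ε := by
    intro ε hε
    have hC0 := h.nonneg
    obtain ⟨N, hN⟩ := exists_pow_lt_of_lt_one (show 0 < ε / (C + 1) by positivity)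
      (by linarith : 1 - lam < 1)
    refine ⟨N, ?_⟩
    have h2 : (1 - lam) ^ (N + 1) ≤ (1 - lam) ^ N :=
      pow_le_pow_of_le_one hl (by linarith) N.le_succ
    have h3 : 0 ≤ (1 - lam) ^ (N + 1) := by positivity
    have h4 := (lt_div_iff₀ (by positivity)).1 (h2.trans_lt hN)
    linarith
  have hpay := fun σ τ N => G.abs_discountedPayoff_sub_le hC h0 h1 k₁ σ τ N
  refine hasValue_and_value_eq (B := C) (fun σ τ => by simpa using hpay σ τ 0) (fun ε hε => ?_)
    fun ε hε => ?_
  -- The three thirds pay for the near-optimal strategy, the final continuation payoff and the tail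
  -- of the discounted sum.
  · obtain ⟨N, hN⟩ := hsmall (ε / 3) (by positivity)
    obtain ⟨σ, hσ⟩ := (G.exists_strategies w f hmv N (hbound (N + 1))
      (show 0 < ε / 3 by positivity)).1
    refine ⟨σ, fun τ => ?_⟩
    have h2 := (abs_le.1 (hpay σ τ (N + 1))).1
    have h3 := hσ τ k₁
    simp only [hf, hw, pow_zero, one_smul] at h3
    linarith
  · obtain ⟨N, hN⟩ := hsmall (ε / 3) (by positivity)
    obtain ⟨τ, hτ⟩ := (G.exists_strategies w f hmv N (hbound (N + 1))
      (show 0 < ε / 3 by positivity)).2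
    refine ⟨τ, fun σ => ?_⟩
    have h2 := (abs_le.1 (hpay σ τ (N + 1))).2
    have h3 := hτ σ k₁
    simp only [hf, hw, pow_zero, one_smul] at h3
    linarith

end Shapley

end StochasticGame

/-! ### Equivalence of the two convergences -/

theorem proposition2 {K I J : Type*}
    [Finite K] [TopologicalSpace K] [DiscreteTopology K] [MeasurableSpace K] [BorelSpace K]
    [TopologicalSpace I] [CompactSpace I] [TopologicalSpace.MetrizableSpace I] [Nonempty I]
    [MeasurableSpace I] [BorelSpace I]
    [TopologicalSpace J] [CompactSpace J] [TopologicalSpace.MetrizableSpace J] [Nonempty J]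
    [MeasurableSpace J] [BorelSpace J]
    (G : StochasticGame K I J) (hG : G.SeparatelyContinuous) :
    -- the finite and the discounted games have a value
    (∀ n : ℕ, 1 ≤ n → ∀ k₁ : K, StochasticGame.HasValue (G.stagePayoff n k₁)) ∧
    (∀ lam : ℝ, 0 < lam → lam ≤ 1 →
      ∀ k₁ : K, StochasticGame.HasValue (G.discountedPayoff lam k₁)) ∧
    -- the two convergence properties are equivalent
    ((∀ k₁ : K, ∃ l : ℝ, Tendsto (fun n => G.stageValue n k₁) atTop (𝓝 l)) ↔
      (∀ k₁ : K, ∃ l : ℝ, Tendsto (fun lam => G.discountedValue lam k₁) (𝓝[>] 0) (𝓝 l))) ∧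
    -- when they hold, the limits are equal
    ((∀ k₁ : K, ∃ l : ℝ, Tendsto (fun n => G.stageValue n k₁) atTop (𝓝 l)) →
      ∀ k₁ : K, ∃ l : ℝ, Tendsto (fun n => G.stageValue n k₁) atTop (𝓝 l) ∧
        Tendsto (fun lam => G.discountedValue lam k₁) (𝓝[>] 0) (𝓝 l)) := by
  have := Fintype.ofFinite K
  obtain ⟨C, hC⟩ : ∃ C, ∀ z, |G.g z| ≤ C := G.bounded_g
  replace hC : ∀ z, |G.g z| ≤ |C| := fun z => (hC z).trans (le_abs_self C)
  have hval : ∀ w f k, ∃ c, IsMixedValue (fun i j => G.oneShot G.g w f (k, i, j)) c := by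
    intro w f k
    obtain ⟨B, hB⟩ := exists_abs_le_of_finite f
    exact exists_isMixedValue (StochasticGame.continuous_oneShot_left hG w f k)
      (G.measurable_uncurry_oneShot w f k) fun i j => G.abs_oneShot_le hC hB w (k, i, j)
  choose Φ hΦ using hval
  have h := G.isShapleyOperator_of_isMixedValue (abs_nonneg C) hC hΦ
  have hfix : ∀ lam : ℝ, ∃ u : K → ℝ, 0 < lam → lam ≤ 1 → Φ lam ((1 - lam) • u) = u := by
    intro lam
    by_cases hl : 0 < lam ∧ lam ≤ 1
    · obtain ⟨u, hu⟩ := h.exists_fixedPoint hl.1 hl.2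
      exact ⟨u, fun _ _ => hu⟩
    · exact ⟨0, fun h0 h1 => absurd ⟨h0, h1⟩ hl⟩
  choose u hu using hfix
  have hstage := fun n hn k₁ => G.hasValue_stagePayoff hC h hΦ (n := n) hn k₁
  have hdisc := fun lam h0 h1 k₁ => G.hasValue_discountedPayoff hC h hΦ h0 h1 (hu lam h0 h1) k₁
  -- Convergence in `K → ℝ` is statewise convergence, and the identification of the values is needed
  -- only eventually, for `n ≥ 1` here and `lam ∈ (0, 1]` below.
  have hstage_iff : ∀ v : K → ℝ, (∀ k, Tendsto (fun n => G.stageValue n k) atTop (𝓝 (v k))) ↔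
      Tendsto (fun n : ℕ => (n : ℝ)⁻¹ • (Φ 1)^[n] 0) atTop (𝓝 v) := by
    intro v
    rw [tendsto_pi_nhds]
    refine forall_congr' fun k => tendsto_congr' ?_
    filter_upwards [eventually_ge_atTop 1] with n hn using (hstage n hn k).2
  have hdisc_iff : ∀ v : K → ℝ,
      (∀ k, Tendsto (fun lam => G.discountedValue lam k) (𝓝[>] 0) (𝓝 (v k))) ↔
      Tendsto u (𝓝[>] 0) (𝓝 v) := by
    intro v
    rw [tendsto_pi_nhds]
    refine forall_congr' fun k => tendsto_congr' ?_
    filter_upwards [Ioc_mem_nhdsGT (zero_lt_one' ℝ)] with lam hl using (hdisc lam hl.1 hl.2 k).2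
  have hto : ∀ v : K → ℝ, (∀ k, Tendsto (fun n => G.stageValue n k) atTop (𝓝 (v k))) →
      ∀ k, Tendsto (fun lam => G.discountedValue lam k) (𝓝[>] 0) (𝓝 (v k)) := fun v hv =>
    (hdisc_iff v).2 (h.tendsto_discounted hu ((hstage_iff v).1 hv))
  refine ⟨fun n hn k₁ => (hstage n hn k₁).1, fun lam h0 h1 k₁ => (hdisc lam h0 h1 k₁).1,
    ⟨fun hs => ?_, fun hd => ?_⟩, fun hs k₁ => ?_⟩
  · choose v hv using hs
    exact fun k => ⟨v k, hto v hv k⟩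
  · choose v hv using hd
    exact fun k => ⟨v k, (hstage_iff v).2 (h.tendsto_iterate hu ((hdisc_iff v).1 hv)) k⟩
  · choose v hv using hs
    exact ⟨v k₁, hv k₁, hto v hv k₁⟩
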